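/- **Setting.** Let $G=(V,E)$ be a finite simple graph with $n$ nodes and maximum degree $\Delta$, and let $W\ge 1$ be an integer. Every node $v$ is an agent with a private weight $w(v)\in\{0,\dots,W\}$ and submits a bid $b(v)\in\{0,\dots,W\}$. A mechanism maps the bid vector $b$ to a set $I(b)\subseteq V$ and payments $p(b)\in\mathbb R^V$. Agent $v$ obtains utility $u_v+p_v$, where $u_v=w(v)$ if $v\in I$ and no neighbour of $v$ is in $I$, and $u_v=0$ otherwise. The mechanism is incentive-compatible if, for all bids of the others, bidding $b(v)=w(v)$ maximises the utility of $v$ over all bids in $\{0,\dots,W\}$. It computes an $\alpha$-approximation if, under truthful bids, $I$ is an independent set and $\sum_v u_v(J)\le\alpha\sum_v u_v(I)$ for every independent set $J$. In the CONGEST model the nodes have distinct identifiers bounded by a polynomial in $n$ and arbitrarily numbered ports. Initially a node knows only $W$, its identifier, its bid and its degree. In every synchronous round it sends a message of $O(\log n)$ bits to each neighbour; local computation is unrestricted. Each node eventually stops and outputs whether it is in $I$ and its payment. **Theorem.** There is an incentive-compatible distributed mechanism for maximum-weight independent set that computes a $\max\{1,\Delta\}$-approximation and runs in $O(\Delta W+\log^*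 n)$ rounds in the CONGEST model: a single deterministic algorithm such that for every $c$ there is a constant $C$ such that, for all $W\ge1$, all $G$, all port numberings and all distinct identifiers in $\{0,\dots,c\,n^c\}$, it computes on every bid vector the outcome and payments of such a mechanism within $C(\Delta W+\log^* n)$ rounds with messages of at most $C\lfloor\log_2 n\rfloor$ bits. Moreover, the mechanism is of the following form. There is a proper colouring $\phi$ of $G$ with $\Delta+1$ colours, independent of the bids. Let $u<_\phi v$ mean that $b(u)<b(v)$, or $b(u)=b(v)$ and $\phi(v)<\phi(u)$. Then $I(b)$ is the output of the greedy algorithm that starts with all nodes active and repeatedly adds to $I$ all active nodes that are larger with respect to $<_\phi$ than all of their active neighbours, and deactivates them and their neighbours, until no node is active. Each $v\in I(b)$ has payment $p_v=-b^*(v)$, where the critical price $b^*(v)$ is the least bid with which $v$ is selected, the other bids being fixed; all other payments are $0$. For $v\in I(b)$ call a neighbour $u<_\phi v$ blocked if it has a neighbour $x\neq v$ with $x\in I(b)$ and $u<_\phi x$. Then $b^*(v)$ is the least bid with which $v$ exceeds, with respect to $<_\phi$, all of its neighbours $u<_\phi v$ that are not blocked; it is $0$ if there are none. -/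

import Mathlib

/-! ### The CONGEST model -/

/-- A deterministic distributed algorithm, run by every node of a network.  A node starts knowing
only the (globally known) maximum weight, its own identifier, its own bid and the number of its
ports; it knows neither the number of nodes nor the maximum degree.  Messages are bit strings (the
empty string is silence); local computation is unrestricted.  A node stops as soon as `output` of
its state is defined; the output says whether the node is selected, and its payment. -/
structure DistAlgorithm where
  State : Type
  init : (maxWeight ident bid degree : ℕ) → State
  /-- the message sent through the given port -/
  send : State → (port : ℕ) → List Bool
  /-- the new state, given the messages received through the ports -/
  receive : State → (inbox : ℕ → List Bool) → State
  output : State → Option (Bool × ℝ)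

/-- A port numbering: every node `v` numbers its neighbours by `0, …, deg v - 1`. -/
abbrev PortNumbering {V : Type} [Fintype V] (G : SimpleGraph V) [DecidableRel G.Adj] : Type :=
  ∀ v : V, Fin (G.degree v) ≃ G.neighborSet v

namespace DistAlgorithm

variable (A : DistAlgorithm) {V : Type} [Fintype V] {G : SimpleGraph V} [DecidableRel G.Adj]

/-- The message that `u` sends to its neighbour `v` when the nodes are in the states `s`.
A node that has stopped sends nothing. -/
def message (ports : PortNumbering G) (s : V → A.State) (u v : V) (h : G.Adj u v) : List Bool :=
  if (A.output (s u)).isSome then [] else A.send (s u) ((ports u).symm ⟨v, h⟩)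

/-- What `v` receives through each of its ports. -/
def inbox (ports : PortNumbering G) (s : V → A.State) (v : V) (i : ℕ) : List Bool :=
  if h : i < G.degree v then
    A.message ports s (ports v ⟨i, h⟩).1 v (G.adj_symm (ports v ⟨i, h⟩).2)
  else []

/-- One synchronous round; nodes that have stopped keep their state. -/
def round (ports : PortNumbering G) (s : V → A.State) (v : V) : A.State :=
  if (A.output (s v)).isSome then s v else A.receive (s v) (A.inbox ports s v)

/-- The states after `t` rounds, with maximum weight `W`, identifiers `ident` and bids `b`. -/
def config (ports : PortNumbering G) (W : ℕ) (ident b : V → ℕ) (t : ℕ) : V → A.State :=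
  (A.round ports)^[t] (fun v => A.init W (ident v) (b v) (G.degree v))

end DistAlgorithm

/-- The iterated logarithm `log* n`: how often the binary logarithm has to be applied to `n` until
the result is at most `1`. -/
noncomputable def logStar (n : ℕ) : ℕ :=
  sInf {k : ℕ | (Real.logb 2)^[k] (n : ℝ) ≤ 1}

/-! ### Mechanisms for maximum-weight independent set -/

/-- A direct mechanism: it maps the bids to a selected set of agents and to payments. -/
structure Mechanism (V : Type) where
  alloc : (V → ℕ) → Finset V
  pay : (V → ℕ) → V → ℝ

/-- Agent `v` with private weight `θ` gains `θ` if it is selected and none of its neighbours is,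
and `0` otherwise. -/
noncomputable def agentUtility {V : Type} (G : SimpleGraph V) (θ : ℕ) (I : Finset V) (v : V) : ℝ :=
  open Classical in if v ∈ I ∧ ∀ u, G.Adj v u → u ∉ I then (θ : ℝ) else 0

namespace Mechanism

variable {V : Type} (M : Mechanism V) (G : SimpleGraph V)

/-- Bidding truthfully is a weakly dominant strategy, weights and bids being in `{0, …, W}`. -/
def IncentiveCompatible [DecidableEq V] (W : ℕ) : Prop :=
  ∀ b : V → ℕ, (∀ u, b u ≤ W) → ∀ v : V, ∀ θ ≤ W, ∀ x ≤ W,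
    agentUtility G θ (M.alloc (Function.update b v x)) v + M.pay (Function.update b v x) v ≤
      agentUtility G θ (M.alloc (Function.update b v θ)) v + M.pay (Function.update b v θ) v

/-- Under truthful bids `w` in `{0, …, W}`, the outcome is an independent set, and its social
welfare is within the factor `α` of that of every independent set. -/
def IsApproximation [Fintype V] (W : ℕ) (α : ℝ) : Prop :=
  ∀ w : V → ℕ, (∀ u, w u ≤ W) →
    G.IsIndepSet (M.alloc w : Set V) ∧
    ∀ J : Finset V, G.IsIndepSet (J : Set V) →
      ∑ v, agentUtility G (w v) J v ≤ α * ∑ v, agentUtility G (w v) (M.alloc w) v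

/-- On every vector of bids in `{0, …, W}`, the algorithm `A` has stopped everywhere after `T`
rounds with the outcome and the payments of `M`, and each of its messages has at most `B` bits. -/
def ComputedBy [Fintype V] [DecidableEq V] {G : SimpleGraph V} [DecidableRel G.Adj]
    (A : DistAlgorithm) (ports : PortNumbering G) (ident : V → ℕ) (W T B : ℕ) : Prop :=
  ∀ b : V → ℕ, (∀ u, b u ≤ W) →
    (∀ v, A.output (A.config ports W ident b T v) = some (decide (v ∈ M.alloc b), M.pay b v)) ∧
    (∀ (t : ℕ) (u v : V) (h : G.Adj u v),
      (A.message ports (A.config ports W ident b t) u v h).length ≤ B)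

end Mechanism

/-! ### The greedy algorithm and its critical prices -/

section Greedy

variable {V : Type} [Fintype V] [DecidableEq V] (G : SimpleGraph V) [DecidableRel G.Adj]
  {k : ℕ} (φ : V → Fin k)

/-- `u` is below `v`: smaller bid or, if the bids are equal, larger colour. -/
def Below (b : V → ℕ) (u v : V) : Prop :=
  b u < b v ∨ (b u = b v ∧ φ v < φ u)

instance (b : V → ℕ) : DecidableRel (Below φ b) := fun _ _ => instDecidableOr

/-- The active nodes above all their active neighbours. -/
def localMaxima (b : V → ℕ) (active : Finset V) : Finset V :=
  {v ∈ active | ∀ u ∈ active, G.Adj v u → Below φ b u v}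

/-- One step on a pair (selected nodes, active nodes): select the local maxima, and deactivate them
and their neighbours. -/
def greedyStep (b : V → ℕ) (s : Finset V × Finset V) : Finset V × Finset V :=
  (s.1 ∪ localMaxima G φ b s.2,
    {v ∈ s.2 | v ∉ localMaxima G φ b s.2 ∧ ∀ u ∈ localMaxima G φ b s.2, ¬ G.Adj u v})

/-- The set selected by the greedy algorithm.  For a proper colouring every step on a nonempty
active set deactivates a node, so `|V|` steps exhaust the graph. -/
def greedySet (b : V → ℕ) : Finset V :=
  ((greedyStep G φ b)^[Fintype.card V] (∅, Finset.univ)).1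

/-- The critical price of `v`: the least bid with which the greedy algorithm selects `v`, the other
bids being fixed. -/
noncomputable def criticalPrice (b : V → ℕ) (v : V) : ℕ :=
  sInf {x : ℕ | v ∈ greedySet G φ (Function.update b v x)}

/-- The neighbour `u` of `v` has a blocking neighbour: a selected neighbour other than `v` that is
above `u`. -/
def Blocked (b : V → ℕ) (v u : V) : Prop :=
  ∃ x, G.Adj u x ∧ x ≠ v ∧ Below φ b u x ∧ x ∈ greedySet G φ b

instance (b : V → ℕ) : DecidableRel (Blocked G φ b) := fun _ _ => Fintype.decidableExistsFintype

/-- The least bid with which `v` is above every neighbour `u` that is below `v` under `b` and has no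
blocking neighbour (`0` if there is none): above `u` are the bids from `b u` on if the tie is broken
in favour of `v`, and those from `b u + 1` on otherwise. -/
def blockingPrice (b : V → ℕ) (v : V) : ℕ :=
  (Finset.univ.filter fun u => G.Adj v u ∧ Below φ b u v ∧ ¬ Blocked G φ b v u).sup
    (fun u => if φ v < φ u then b u else b u + 1)

/-- The greedy algorithm as a mechanism: every selected agent pays its critical price. -/
noncomputable def greedyMechanism : Mechanism V where
  alloc := greedySet G φ
  pay b v := if v ∈ greedySet G φ b then -(criticalPrice G φ b v : ℝ) else 0

end Greedy

/-! Mechanism. For a proper colouring `Below` orients every edge acyclically, so there is exactly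
one set consisting of the nodes without a selected neighbour above them (`IsKernel`), and the greedy
set is this kernel (`isKernel_greedySet`). Changing the bid of a selected node v leaves the kernel
intact as long as every neighbour that loses v as a dominator has another selected node above it;
otherwise v drops out. Hence the winning bids of v form an up-set beginning at `blockingPrice`
(`mem_greedySet_update_iff_blockingPrice_le`). Truthfulness is the usual threshold-price argument,
and the approximation factor comes from charging each node of a competing independent set to a
selected node at least as heavy, either itself or a neighbour.

Colouring. The nodes know neither n nor Δ, so each works with its own scale i, for which deg < 2 ^
i. A Linial-type reduction by polynomials over prime fields shrinks the identifiers in log* n + O(1)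
rounds to colours of level 0, proper within each scale (`colourRun_lin_spec`). Each node then tries
the values of a quartic polynomial over a field of size Θ(2 ^ i): a neighbour spoils at most 7
trials of a period, so O(Δ) rounds fix one of O(2 ^ i) preliminary colours (`exists_fin`). Finally
the nodes choose the least free colour in the order of scale and preliminary colour, again in O(Δ)
rounds and with colours at most the degree (`exists_coloring`).

Auction. Bids are sent bit by bit. Nodes decide from the top of `Below` downwards; the rank (W - b
v)(Δ + 1) + φ v bounds the waiting time, which gives O(ΔW) rounds (`sel_isSome`). Prices need only
one broadcast bit per node: a node u below a selected neighbour v is blocked, from the point of view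
of v, exactly if at least two selected neighbours lie above u (`netRun_price_eq`). A node stops when
all its neighbours know their prices, so that silence is unambiguous (`config_eq_netRun`). -/

set_option linter.unusedSectionVars false

/-! ### The greedy set as a kernel: critical prices, truthfulness, approximation -/

section GreedyTheory

variable {V : Type} {k : ℕ} {φ : V → Fin k}

theorem Below.trans {b : V → ℕ} {u v w : V} (h₁ : Below φ b u v) (h₂ : Below φ b v w) :
    Below φ b u w := by
  unfold Below at *
  omega

theorem Below.irrefl (b : V → ℕ) (v : V) : ¬ Below φ b v v := by
  simp [Below]

theorem Below.asymm {b : V → ℕ} {u v : V} (h : Below φ b u v) : ¬ Below φ b v u :=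
  fun h' => Below.irrefl b u (h.trans h')

theorem below_or_below {G : SimpleGraph V} (hφ : ∀ u v, G.Adj u v → φ u ≠ φ v) (b : V → ℕ)
    {u v : V} (h : G.Adj u v) : Below φ b u v ∨ Below φ b v u := by
  have := hφ u v h
  unfold Below
  omega

theorem below_update_iff [DecidableEq V] (b : V → ℕ) {u v : V} (x : ℕ) (hne : u ≠ v) :
    Below φ (Function.update b v x) u v ↔ (if φ v < φ u then b u else b u + 1) ≤ x := by
  unfold Below
  rw [Function.update_self, Function.update_of_ne hne]
  split_ifs with h <;> omega

theorem below_update_of_ne [DecidableEq V] (b : V → ℕ) {u v w : V} (x : ℕ) (hu : u ≠ v)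
    (hw : w ≠ v) : Below φ (Function.update b v x) u w ↔ Below φ b u w := by
  unfold Below
  rw [Function.update_of_ne hw, Function.update_of_ne hu]

variable [Fintype V]

theorem wellFounded_below (b : V → ℕ) : WellFounded fun u v => Below φ b v u := by
  have : IsStrictOrder V fun u v => Below φ b v u :=
    { irrefl := fun v => Below.irrefl b v
      trans := fun _ _ _ h₁ h₂ => h₂.trans h₁ }
  exact Finite.wellFounded_of_trans_of_irrefl _

/-- A set is a kernel if it consists of the nodes without a selected neighbour above them. -/
def IsKernel (G : SimpleGraph V) (φ : V → Fin k) (b : V → ℕ) (S : Finset V) : Prop :=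
  ∀ v, v ∈ S ↔ ∀ u, G.Adj v u → Below φ b v u → u ∉ S

variable {G : SimpleGraph V}

/-- Membership of a node depends only on the nodes above it, so it is determined by recursion from
the top of the finite order. -/
theorem IsKernel.unique {b : V → ℕ} {S T : Finset V} (hS : IsKernel G φ b S)
    (hT : IsKernel G φ b T) : S = T := by
  ext v
  induction v using (wellFounded_below (φ := φ) b).induction with
  | _ v ih =>
    rw [hS v, hT v]
    exact forall_congr' fun u => forall_congr' fun _ => forall_congr' fun hb => by rw [ih u hb]

theorem IsKernel.not_mem_of_adj (hφ : ∀ u v, G.Adj u v → φ u ≠ φ v) {b : V → ℕ} {S : Finset V}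
    (hS : IsKernel G φ b S) {u v : V} (h : G.Adj u v) (hu : u ∈ S) : v ∉ S := by
  intro hv
  rcases below_or_below hφ b h with hb | hb
  · exact (hS u).1 hu v h hb hv
  · exact (hS v).1 hv u h.symm hb hu

theorem IsKernel.exists_above {b : V → ℕ} {S : Finset V} (hS : IsKernel G φ b S) {v : V}
    (hv : v ∉ S) : ∃ u, G.Adj v u ∧ Below φ b v u ∧ u ∈ S := by
  rw [hS v] at hv
  push Not at hv
  exact hv

variable [DecidableEq V] [DecidableRel G.Adj]

theorem localMaxima_nonempty (hφ : ∀ u v, G.Adj u v → φ u ≠ φ v) (b : V → ℕ) {s : Finset V}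
    (hs : s.Nonempty) : (localMaxima G φ b s).Nonempty := by
  obtain ⟨m, hm, hmax⟩ := (wellFounded_below (φ := φ) b).has_min (s : Set V) hs
  refine ⟨m, Finset.mem_filter.2 ⟨hm, fun u hu hadj => ?_⟩⟩
  exact (below_or_below hφ b hadj).resolve_left (hmax u hu)

/-- The third clause is the substance: a node deactivated without being selected was an active
neighbour of a local maximum, which is therefore above it. The last clause bounds the number of
steps, since a nonempty active set always has a local maximum. -/
theorem greedyStep_invariant (hφ : ∀ u v, G.Adj u v → φ u ≠ φ v) (b : V → ℕ) (m : ℕ) :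
    let s := (greedyStep G φ b)^[m] (∅, Finset.univ)
    (∀ v ∈ s.2, v ∉ s.1) ∧ (∀ v ∈ s.1, ∀ u, G.Adj v u → u ∉ s.1 ∧ u ∉ s.2) ∧
    (∀ v, v ∉ s.2 → v ∉ s.1 → ∃ u, G.Adj v u ∧ Below φ b v u ∧ u ∈ s.1) ∧
    s.2.card ≤ Fintype.card V - m := by
  induction m with
  | zero => simp
  | succ m ih =>
    simp only [Function.iterate_succ_apply']
    generalize (greedyStep G φ b)^[m] (∅, Finset.univ) = s at ih ⊢
    obtain ⟨h₁, h₂, h₃, h₄⟩ := ih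
    have hL : ∀ v, v ∈ localMaxima G φ b s.2 ↔ v ∈ s.2 ∧ ∀ u ∈ s.2, G.Adj v u → Below φ b u v :=
      fun v => Finset.mem_filter
    have hA : ∀ v, v ∈ (greedyStep G φ b s).2 ↔ v ∈ s.2 ∧ v ∉ localMaxima G φ b s.2 ∧
        ∀ u ∈ localMaxima G φ b s.2, ¬ G.Adj u v := fun v => Finset.mem_filter
    have hS : ∀ v, v ∈ (greedyStep G φ b s).1 ↔ v ∈ s.1 ∨ v ∈ localMaxima G φ b s.2 :=
      fun v => Finset.mem_union
    have hindep : ∀ v ∈ localMaxima G φ b s.2, ∀ u, G.Adj v u → u ∉ localMaxima G φ b s.2 :=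
      fun v hv u hvu hu =>
        (((hL v).1 hv).2 u ((hL u).1 hu).1 hvu).asymm (((hL u).1 hu).2 v ((hL v).1 hv).1 hvu.symm)
    refine ⟨fun v hv => ?_, fun v hv u hvu => ?_, fun v hv hv' => ?_, ?_⟩
    · rw [hA] at hv
      rw [hS]
      rintro (h | h)
      exacts [h₁ v hv.1 h, hv.2.1 h]
    · rw [hS] at hv
      rw [hS, hA]
      rcases hv with hv | hv
      · obtain ⟨h, h'⟩ := h₂ v hv u hvu
        exact ⟨fun H => H.elim h fun H => h' ((hL u).1 H).1, fun H => h' H.1⟩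
      · exact ⟨fun H => H.elim (fun H => (h₂ u H v hvu.symm).2 ((hL v).1 hv).1) (hindep v hv u hvu),
          fun H => H.2.2 v hv hvu⟩
    · rw [hS] at hv'
      push Not at hv'
      by_cases hv2 : v ∈ s.2
      · have : ∃ u ∈ localMaxima G φ b s.2, G.Adj u v := by
          by_contra! H
          exact hv ((hA v).2 ⟨hv2, hv'.2, H⟩)
        obtain ⟨u, hu, huv⟩ := this
        exact ⟨u, huv.symm, ((hL u).1 hu).2 v hv2 huv, (hS u).2 (Or.inr hu)⟩
      · obtain ⟨u, hvu, hb, hu⟩ := h₃ v hv2 hv'.1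
        exact ⟨u, hvu, hb, (hS u).2 (Or.inl hu)⟩
    · rcases s.2.eq_empty_or_nonempty with h | h
      · have : (greedyStep G φ b s).2 = ∅ := by
          ext v
          simp [hA, h]
        simp [this]
      · obtain ⟨m', hm'⟩ := localMaxima_nonempty hφ b h
        have : (greedyStep G φ b s).2.card < s.2.card := by
          refine Finset.card_lt_card ⟨fun v hv => ((hA v).1 hv).1, fun H => ?_⟩
          exact ((hA m').1 (H ((hL m').1 hm').1)).2.1 hm'
        omega

theorem isKernel_greedySet (hφ : ∀ u v, G.Adj u v → φ u ≠ φ v) (b : V → ℕ) :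
    IsKernel G φ b (greedySet G φ b) := by
  obtain ⟨-, h₂, h₃, h₄⟩ := greedyStep_invariant hφ b (Fintype.card V)
  rw [Nat.sub_self, Nat.le_zero, Finset.card_eq_zero] at h₄
  intro v
  refine ⟨fun hv u hvu _ => (h₂ v hv u hvu).1, fun h => ?_⟩
  by_contra hv
  obtain ⟨u, hvu, hb, hu⟩ := h₃ v (by simp [h₄]) hv
  exact h u hvu hb hu

theorem IsKernel.eq_greedySet (hφ : ∀ u v, G.Adj u v → φ u ≠ φ v) {b : V → ℕ} {S : Finset V}
    (hS : IsKernel G φ b S) : S = greedySet G φ b :=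
  hS.unique (isKernel_greedySet hφ b)

theorem greedySet_isIndepSet (hφ : ∀ u v, G.Adj u v → φ u ≠ φ v) (b : V → ℕ) :
    G.IsIndepSet (greedySet G φ b : Set V) := fun _ hu _ hv _ h =>
  (isKernel_greedySet hφ b).not_mem_of_adj hφ h hu hv

/-- A selected node stays selected with bid `x` exactly if it remains above its unblocked lower
neighbours. -/
theorem mem_greedySet_update_iff (hφ : ∀ u v, G.Adj u v → φ u ≠ φ v) {b : V → ℕ} {v : V}
    (hv : v ∈ greedySet G φ b) (x : ℕ) :
    v ∈ greedySet G φ (Function.update b v x) ↔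
      ∀ u, G.Adj v u → Below φ b u v → ¬ Blocked G φ b v u →
        Below φ (Function.update b v x) u v := by
  have hS := isKernel_greedySet (G := G) hφ b
  have hS' := isKernel_greedySet (G := G) hφ (Function.update b v x)
  constructor
  · intro hv' u hvu hb hbl
    by_contra hux
    have huv : u ≠ v := hvu.ne'
    -- The bid `b v` puts v above u and `x` does not.
    have hxb : x ≤ b v := by
      rw [below_update_iff b x huv] at hux
      unfold Below at hb
      split_ifs at hux <;> omega
    -- Raising the bid of v from `x` to `b v` only adds relations of the form "below v". As v is
    -- already selected, its neighbours are unselected anyway, so the kernel for `x` is one for `b`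
    -- as well.
    have hker : IsKernel G φ b (greedySet G φ (Function.update b v x)) := by
      intro w
      refine ⟨fun hw u hwu _ => hS'.not_mem_of_adj hφ hwu hw, fun hw => ?_⟩
      by_contra hw'
      obtain ⟨y, hwy, hby, hy⟩ := hS'.exists_above hw'
      have hwv : w ≠ v := by rintro rfl; exact hw' hv'
      refine hw y hwy ?_ hy
      by_cases hyv : y = v
      · subst hyv
        rw [below_update_iff b x hwv] at hby
        unfold Below
        split_ifs at hby <;> omega
      · exact (below_update_of_ne b x hwv hyv).1 hby
    -- By uniqueness both bids give the same set. The unselected u needs a selected node above it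
    -- under the bid `x`, and this is not v, so u is blocked.
    rw [hker.eq_greedySet hφ] at hS'
    obtain ⟨y, huy, hby, hy⟩ := hS'.exists_above (hS.not_mem_of_adj hφ hvu hv)
    have hyv : y ≠ v := by rintro rfl; exact hux hby
    exact hbl ⟨y, huy, hyv, (below_update_of_ne b x huv hyv).1 hby, hy⟩
  · intro h
    -- A neighbour that v dominated under `b` either remains below v or keeps its blocking
    -- neighbour, whose relation to it does not involve the bid of v.
    have hker : IsKernel G φ (Function.update b v x) (greedySet G φ b) := by
      intro w
      refine ⟨fun hw u hwu _ => hS.not_mem_of_adj hφ hwu hw, fun hw => ?_⟩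
      by_contra hw'
      have hwv : w ≠ v := by rintro rfl; exact hw' hv
      obtain ⟨y, hwy, hby, hy⟩ := hS.exists_above hw'
      by_cases hyv : y = v
      · subst hyv
        by_cases hbl : Blocked G φ b y w
        · obtain ⟨z, hwz, hzv, hbz, hz⟩ := hbl
          exact hw z hwz ((below_update_of_ne b x hwv hzv).2 hbz) hz
        · exact hw y hwy (h w hwy.symm hby hbl) hy
      · exact hw y hwy ((below_update_of_ne b x hwv hyv).2 hby) hy
    rwa [← hker.eq_greedySet hφ]

theorem mem_greedySet_update_iff_blockingPrice_le (hφ : ∀ u v, G.Adj u v → φ u ≠ φ v)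
    {b : V → ℕ} {v : V} (hv : v ∈ greedySet G φ b) (x : ℕ) :
    v ∈ greedySet G φ (Function.update b v x) ↔ blockingPrice G φ b v ≤ x := by
  rw [mem_greedySet_update_iff hφ hv, blockingPrice, Finset.sup_le_iff]
  refine forall_congr' fun u => ?_
  simp only [Finset.mem_filter, Finset.mem_univ, true_and, and_imp]
  refine forall_congr' fun hadj => ?_
  rw [below_update_iff b x hadj.ne']

theorem criticalPrice_eq_blockingPrice (hφ : ∀ u v, G.Adj u v → φ u ≠ φ v)
    {b : V → ℕ} {v : V} (hv : v ∈ greedySet G φ b) :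
    criticalPrice G φ b v = blockingPrice G φ b v := by
  have : {x : ℕ | v ∈ greedySet G φ (Function.update b v x)} =
      Set.Ici (blockingPrice G φ b v) := by
    ext x
    exact mem_greedySet_update_iff_blockingPrice_le hφ hv x
  rw [criticalPrice, this, csInf_Ici]

/-- The critical price ignores the bid of v itself, so a single winning bid `y` suffices to identify
it as the threshold. Without a winning bid the infimum is that of the empty set, namely 0, and the
equivalence fails. -/
theorem mem_greedySet_update_iff_criticalPrice_le (hφ : ∀ u v, G.Adj u v → φ u ≠ φ v)
    {b : V → ℕ} {v : V} {y : ℕ} (hy : v ∈ greedySet G φ (Function.update b v y)) (x : ℕ) :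
    v ∈ greedySet G φ (Function.update b v x) ↔ criticalPrice G φ b v ≤ x := by
  have h := mem_greedySet_update_iff_blockingPrice_le hφ hy x
  rw [← criticalPrice_eq_blockingPrice hφ hy] at h
  simpa [criticalPrice] using h

theorem criticalPrice_update (b : V → ℕ) (v : V) (x : ℕ) :
    criticalPrice G φ (Function.update b v x) v = criticalPrice G φ b v := by
  simp [criticalPrice]

theorem agentUtility_of_mem {θ : ℕ} {I : Finset V} {v : V} (hI : G.IsIndepSet (I : Set V))
    (hv : v ∈ I) : agentUtility G θ I v = θ :=
  if_pos ⟨hv, fun _ huv hu => hI hv hu huv.ne huv⟩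

theorem agentUtility_of_not_mem {θ : ℕ} {I : Finset V} {v : V} (hv : v ∉ I) :
    agentUtility G θ I v = 0 :=
  if_neg fun h => hv h.1

theorem greedyMechanism_incentiveCompatible (hφ : ∀ u v, G.Adj u v → φ u ≠ φ v) (W : ℕ) :
    (greedyMechanism G φ).IncentiveCompatible G W := by
  intro b _ v θ _ x _
  -- The bid decides only between the outcomes θ minus a fixed price and 0. Truth picks the better
  -- one, as a node wins exactly from the price on.
  have key : ∀ y, agentUtility G θ ((greedyMechanism G φ).alloc (Function.update b v y)) v +
      (greedyMechanism G φ).pay (Function.update b v y) v =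
      if v ∈ greedySet G φ (Function.update b v y) then (θ : ℝ) - criticalPrice G φ b v else 0 := by
    intro y
    simp only [greedyMechanism, criticalPrice_update]
    split_ifs with h
    · rw [agentUtility_of_mem (greedySet_isIndepSet hφ _) h, sub_eq_add_neg]
    · rw [agentUtility_of_not_mem h, add_zero]
  rw [key, key]
  by_cases hx : v ∈ greedySet G φ (Function.update b v x)
  · by_cases hθ : v ∈ greedySet G φ (Function.update b v θ)
    · simp [hx, hθ]
    · rw [if_pos hx, if_neg hθ]
      rw [mem_greedySet_update_iff_criticalPrice_le hφ hx] at hθ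
      have : (θ : ℝ) < criticalPrice G φ b v := by exact_mod_cast not_le.1 hθ
      linarith
  · rw [if_neg hx]
    split_ifs with hθ
    · have := (mem_greedySet_update_iff_criticalPrice_le hφ hθ θ).1 hθ
      have : (criticalPrice G φ b v : ℝ) ≤ θ := by exact_mod_cast this
      linarith
    · exact le_rfl

theorem sum_agentUtility {I : Finset V} (hI : G.IsIndepSet (I : Set V)) (w : V → ℕ) :
    ∑ v, agentUtility G (w v) I v = ∑ v ∈ I, (w v : ℝ) := by
  rw [← Finset.sum_filter_add_sum_filter_not Finset.univ (· ∈ I), Finset.filter_mem_eq_inter,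
    Finset.univ_inter, Finset.sum_congr rfl fun v hv => agentUtility_of_mem hI hv,
    Finset.sum_eq_zero fun v hv => agentUtility_of_not_mem (Finset.mem_filter.1 hv).2, add_zero]

theorem greedyMechanism_isApproximation (hφ : ∀ u v, G.Adj u v → φ u ≠ φ v) (W : ℕ) :
    (greedyMechanism G φ).IsApproximation G W (max 1 (G.maxDegree : ℝ)) := by
  intro w _
  have hS := isKernel_greedySet (G := G) hφ w
  refine ⟨greedySet_isIndepSet hφ w, fun J hJ => ?_⟩
  change _ ≤ _ * ∑ v, agentUtility G (w v) (greedySet G φ w) v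
  rw [sum_agentUtility hJ, sum_agentUtility (greedySet_isIndepSet hφ w)]
  -- Charge v to itself if selected, otherwise to a selected neighbour above it, which has at least
  -- its weight.
  have hf : ∀ v, ∃ u ∈ greedySet G φ w, (u = v ∨ G.Adj u v ∧ v ∉ greedySet G φ w) ∧ w v ≤ w u := by
    intro v
    by_cases hv : v ∈ greedySet G φ w
    · exact ⟨v, hv, Or.inl rfl, le_rfl⟩
    · obtain ⟨u, hvu, hb, hu⟩ := hS.exists_above hv
      refine ⟨u, hu, Or.inr ⟨hvu.symm, hv⟩, ?_⟩
      unfold Below at hb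
      omega
  choose f hfS hfadj hfw using hf
  -- If u is in `J`, independence leaves u alone to be charged to u. Otherwise only neighbours of u
  -- are charged to it.
  have hcard : ∀ u ∈ greedySet G φ w,
      (({v ∈ J | f v = u}.card : ℕ) : ℝ) ≤ max 1 (G.maxDegree : ℝ) := by
    intro u _
    by_cases huJ : u ∈ J
    · refine le_max_of_le_left ?_
      have : {v ∈ J | f v = u} ⊆ {u} := by
        intro v hv
        obtain ⟨hvJ, rfl⟩ := Finset.mem_filter.1 hv
        rcases hfadj v with h | h
        · simpa using h.symm
        · exact absurd h.1 (hJ huJ hvJ h.1.ne)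
      exact_mod_cast Finset.card_le_card this
    · refine le_max_of_le_right ?_
      have : {v ∈ J | f v = u} ⊆ G.neighborFinset u := by
        intro v hv
        obtain ⟨hvJ, rfl⟩ := Finset.mem_filter.1 hv
        rcases hfadj v with h | h
        · exact absurd (by rwa [h]) huJ
        · simpa using h.1
      have := (Finset.card_le_card this).trans_eq (G.card_neighborFinset_eq_degree u)
      exact_mod_cast this.trans (G.degree_le_maxDegree u)
  calc ∑ v ∈ J, (w v : ℝ) ≤ ∑ v ∈ J, (w (f v) : ℝ) :=
        Finset.sum_le_sum fun v _ => by exact_mod_cast hfw v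
    _ = ∑ u ∈ greedySet G φ w, ∑ v ∈ J with f v = u, (w (f v) : ℝ) :=
        (Finset.sum_fiberwise_of_maps_to (fun v _ => hfS v) _).symm
    _ = ∑ u ∈ greedySet G φ w, ({v ∈ J | f v = u}.card : ℝ) * w u := by
        refine Finset.sum_congr rfl fun u _ => ?_
        rw [← nsmul_eq_mul, ← Finset.sum_const]
        exact Finset.sum_congr rfl fun v hv => by rw [(Finset.mem_filter.1 hv).2]
    _ ≤ ∑ u ∈ greedySet G φ w, max 1 (G.maxDegree : ℝ) * w u :=
        Finset.sum_le_sum fun u hu => mul_le_mul_of_nonneg_right (hcard u hu) (Nat.cast_nonneg _)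
    _ = _ := (Finset.mul_sum _ _ _).symm

end GreedyTheory

/-! ### Polynomial families over prime fields, towers and the iterated logarithm -/

section Arithmetic

open Polynomial

/-- Distinct numbers below `q ^ s` get distinct polynomials of degree less than `s` over `ZMod q`. -/
theorem exists_polynomial_family (q s : ℕ) [Fact q.Prime] :
    ∃ f : ℕ → (ZMod q)[X], (∀ x, (f x).degree < s) ∧ Set.InjOn f (Set.Iio (q ^ s)) := by
  have hq : Fintype.card (Fin s → ZMod q) = q ^ s := by simp [ZMod.card]
  let e : Fin (q ^ s) ≃ (Fin s → ZMod q) := (Fintype.equivFinOfCardEq hq).symm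
  have hpos : 0 < q ^ s := pow_pos (Fact.out : q.Prime).pos s
  let g : ℕ → Fin (q ^ s) := fun x => if h : x < q ^ s then ⟨x, h⟩ else ⟨0, hpos⟩
  refine ⟨fun x => ((degreeLTEquiv (ZMod q) s).symm (e (g x)) : degreeLT (ZMod q) s),
    fun x => mem_degreeLT.1 (Subtype.property _), fun x hx y hy hxy => ?_⟩
  have := e.injective ((degreeLTEquiv (ZMod q) s).symm.injective (Subtype.ext hxy))
  simpa [g, Set.mem_Iio.1 hx, Set.mem_Iio.1 hy] using this

/-- Distinct polynomials whose difference has degree at most `m` agree at at most `m` points. -/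
theorem card_filter_eval_eq_le {q : ℕ} [Fact q.Prime] {p r : (ZMod q)[X]} {m : ℕ} (hne : p ≠ r)
    (hdeg : (p - r).natDegree ≤ m) :
    (Finset.univ.filter fun z : ZMod q => p.eval z = r.eval z).card ≤ m := by
  have hne' : p - r ≠ 0 := sub_ne_zero.2 hne
  calc _ ≤ (p - r).roots.toFinset.card := Finset.card_le_card fun z hz => by
          simp only [Finset.mem_filter, Finset.mem_univ, true_and] at hz
          simp [hne', hz]
    _ ≤ (p - r).roots.card := Multiset.toFinset_card_le _
    _ ≤ m := (card_roots' _).trans hdeg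

/-- A family of functions `ℕ → ℕ → ℕ` with values below `q`, any two distinct members with indices
below `m` agreeing at few points below `q`. -/
theorem exists_separated_family {q s m : ℕ} (hq : q.Prime) (hs : 1 ≤ s) (hm : m ≤ q ^ s) :
    ∃ F : ℕ → ℕ → ℕ, (∀ x z, F x z < q) ∧
      ∀ x < m, ∀ y < m, x ≠ y → ((Finset.range q).filter fun z => F x z = F y z).card ≤ s - 1 := by
  have : Fact q.Prime := ⟨hq⟩
  obtain ⟨f, hdeg, hinj⟩ := exists_polynomial_family q s
  refine ⟨fun x z => ((f x).eval (z : ZMod q)).val, fun x z => ZMod.val_lt _,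
    fun x hx y hy hxy => ?_⟩
  have hne : f x ≠ f y := fun h => hxy (hinj (hx.trans_le hm) (hy.trans_le hm) h)
  have hd : (f x - f y).natDegree ≤ s - 1 := by
    have : (f x - f y).degree < s := (degree_sub_le _ _).trans_lt (max_lt (hdeg x) (hdeg y))
    have := (natDegree_lt_iff_degree_lt (sub_ne_zero.2 hne)).2 this
    omega
  refine le_trans ?_ (card_filter_eval_eq_le hne hd)
  refine Finset.card_le_card_of_injOn (fun z => (z : ZMod q)) (fun z hz => ?_)
    fun z hz z' hz' h => ?_
  · simp only [Finset.coe_filter, Finset.mem_range, Set.mem_ofPred_eq] at hz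
    simpa using ZMod.val_injective q hz.2
  · simp only [Finset.coe_filter, Finset.mem_range, Set.mem_ofPred_eq] at hz hz'
    have := congrArg ZMod.val h
    simpa [ZMod.val_natCast, Nat.mod_eq_of_lt hz.1, Nat.mod_eq_of_lt hz'.1] using this

/-- A family of sequences with values below `q` in which, during `q` consecutive steps, distinct
members agree rarely, and no member often attains the same value. -/
theorem exists_trial_family {q m : ℕ} (hq : q.Prime) (hm : m ≤ q ^ 4) :
    ∃ F : ℕ → ℕ → ℕ, (∀ x z, F x z < q) ∧
      (∀ x < m, ∀ y < m, x ≠ y → ∀ a,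
        ((Finset.range q).filter fun z => F x (a + z) = F y (a + z)).card ≤ 3) ∧
      ∀ x a c, ((Finset.range q).filter fun z => F x (a + z) = c).card ≤ 4 := by
  have : Fact q.Prime := ⟨hq⟩
  obtain ⟨f, hdeg, hinj⟩ := exists_polynomial_family q 4
  -- A window of q consecutive times visits every residue once, wherever it begins.
  have hmap : ∀ (p : ZMod q → Prop) [DecidablePred p] (a : ℕ),
      ((Finset.range q).filter fun z => p ((a + z : ℕ) : ZMod q)).card ≤
        (Finset.univ.filter p).card := by
    intro p _ a
    refine Finset.card_le_card_of_injOn (fun z => ((a + z : ℕ) : ZMod q)) (fun z hz => ?_)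
      fun z hz z' hz' h => ?_
    · simp only [Finset.coe_filter, Finset.mem_range, Set.mem_ofPred_eq] at hz
      simpa using hz.2
    · simp only [Finset.coe_filter, Finset.mem_range, Set.mem_ofPred_eq] at hz hz'
      simp only [Nat.cast_add, add_right_inj] at h
      have := congrArg ZMod.val h
      simpa [ZMod.val_natCast, Nat.mod_eq_of_lt hz.1, Nat.mod_eq_of_lt hz'.1] using this
  -- The common term X ^ 4 makes every member nonconstant, so no value is taken more than 4 times.
  -- It cancels in differences, which keep degree at most 3.
  have hmonic : ∀ x, (X ^ 4 + f x).natDegree = 4 := fun x =>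
    natDegree_eq_of_degree_eq_some (by
      rw [degree_add_eq_left_of_degree_lt] <;> rw [degree_X_pow]
      exact hdeg x)
  refine ⟨fun x z => ((X ^ 4 + f x).eval (z : ZMod q)).val, fun x z => ZMod.val_lt _,
    fun x hx y hy hxy a => ?_, fun x a c => ?_⟩
  · have hne : f x ≠ f y := fun h => hxy (hinj (hx.trans_le hm) (hy.trans_le hm) h)
    have hd : (X ^ 4 + f x - (X ^ 4 + f y)).natDegree ≤ 3 := by
      rw [add_sub_add_left_eq_sub]
      have : (f x - f y).degree < (4 : ℕ) := (degree_sub_le _ _).trans_lt (max_lt (hdeg x) (hdeg y))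
      have := (natDegree_lt_iff_degree_lt (sub_ne_zero.2 hne)).2 this
      omega
    refine le_trans ?_ (card_filter_eval_eq_le (by simpa using hne) hd)
    refine le_trans (Finset.card_le_card fun z hz => ?_) (hmap _ a)
    rw [Finset.mem_filter] at hz ⊢
    exact ⟨hz.1, ZMod.val_injective q hz.2⟩
  · have hne : X ^ 4 + f x ≠ C (c : ZMod q) := fun h => by
      have := hmonic x
      rw [h, natDegree_C] at this
      omega
    refine le_trans ?_ (card_filter_eval_eq_le hne ((natDegree_sub_C).trans (hmonic x)).le)
    refine le_trans (Finset.card_le_card fun z hz => ?_) (hmap _ a)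
    rw [Finset.mem_filter] at hz ⊢
    refine ⟨hz.1, ?_⟩
    rw [eval_C, ← hz.2, ZMod.natCast_zmod_val]

/-- Exponents growing like a tower of twos. -/
def towerExp (i : ℕ) : ℕ → ℕ
  | 0 => i + 5
  | k + 1 => 2 ^ (towerExp i k - 2)

/-- Binary length of the colours of level `k` in a graph of maximum degree at most `2 ^ i`. -/
def levelSize (i k : ℕ) : ℕ := 2 * i + 2 + 2 * towerExp i k

theorem towerExp_lt_succ (i k : ℕ) (h : 5 ≤ towerExp i k) : towerExp i k < towerExp i (k + 1) := by
  have : ∀ m, m + 5 < 2 ^ (m + 3) := by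
    intro m
    induction m with
    | zero => norm_num
    | succ m ih => rw [show m + 1 + 3 = (m + 3) + 1 from rfl, pow_succ]; omega
  have := this (towerExp i k - 5)
  rw [towerExp]
  rw [show towerExp i k - 5 + 3 = towerExp i k - 2 by omega] at this
  omega

theorem le_towerExp (i k : ℕ) : i + 5 + k ≤ towerExp i k := by
  induction k with
  | zero => simp [towerExp]
  | succ k ih =>
    have := towerExp_lt_succ i k (by omega)
    omega

/-- With e = `towerExp i k`, the 2 subtracted in the tower exponent turns 2 * 2 ^ (e - 2) into half
of 2 ^ e, and the other half absorbs 2i + 2. The bound makes q at most 2 ^ (i + 1 + e) in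
`exists_level_family`, which is why `levelSize` is twice that exponent. -/
theorem levelSize_succ_le (i k : ℕ) : levelSize i (k + 1) ≤ 2 ^ towerExp i k := by
  have h := le_towerExp i k
  have : ∀ m, 2 * m + 2 ≤ 2 ^ (m + 4) := by
    intro m
    induction m with
    | zero => norm_num
    | succ m ih => rw [show m + 1 + 4 = (m + 4) + 1 from rfl, pow_succ]; omega
  have h1 := this i
  have h2 : 2 ^ (i + 4) ≤ 2 ^ (towerExp i k - 1) := Nat.pow_le_pow_right (by norm_num) (by omega)
  have h3 : 2 ^ (towerExp i k - 1) = 2 * 2 ^ (towerExp i k - 2) := by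
    rw [← pow_succ']; congr 1; omega
  have h4 : 2 ^ towerExp i k = 2 * 2 ^ (towerExp i k - 1) := by
    rw [← pow_succ']; congr 1; omega
  rw [levelSize, towerExp]
  omega

/-- The colours of level `k + 1` are points of a family of functions whose graphs consist of colours
of level `k`, and which are so far apart that a function cannot be covered by `2 ^ i` others. -/
theorem exists_level_family (i k : ℕ) : ∃ (q : ℕ) (F : ℕ → ℕ → ℕ), (∀ x z, F x z < q) ∧
    q * q ≤ 2 ^ levelSize i k ∧
    ∃ s, 2 ≤ s ∧ 2 ^ i * (s - 1) < q ∧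
      ∀ x < 2 ^ levelSize i (k + 1), ∀ y < 2 ^ levelSize i (k + 1), x ≠ y →
        ((Finset.range q).filter fun z => F x z = F y z).card ≤ s - 1 := by
  have hs : 2 ≤ levelSize i (k + 1) := by unfold levelSize; omega
  have hpos : 2 ^ i * levelSize i (k + 1) ≠ 0 :=
    mul_ne_zero (by positivity) (by omega)
  -- With s the length of a colour of level k + 1, Bertrand's postulate gives a prime above 2 ^ i *
  -- s, more than the points spoilt by 2 ^ i neighbours, and at most twice as large.
  obtain ⟨q, hq, hlt, hle⟩ := Nat.exists_prime_lt_and_le_two_mul _ hpos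
  obtain ⟨F, hF, hF'⟩ := exists_separated_family (m := 2 ^ levelSize i (k + 1))
    (s := levelSize i (k + 1)) hq (by omega) (Nat.pow_le_pow_left hq.two_le _)
  refine ⟨q, F, hF, ?_, levelSize i (k + 1), hs, ?_, hF'⟩
  · have : q ≤ 2 ^ (i + 1 + towerExp i k) := by
      calc q ≤ 2 * (2 ^ i * levelSize i (k + 1)) := hle
        _ ≤ 2 * (2 ^ i * 2 ^ towerExp i k) := by gcongr; exact levelSize_succ_le i k
        _ = _ := by ring
    calc q * q ≤ 2 ^ (i + 1 + towerExp i k) * 2 ^ (i + 1 + towerExp i k) := Nat.mul_le_mul this this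
      _ = _ := by rw [← pow_add, levelSize]; congr 1; ring
  · exact lt_of_le_of_lt (Nat.mul_le_mul_left _ (Nat.sub_le _ _)) hlt

/-- The trials for the colours of level `0`. -/
theorem exists_palette_family (i : ℕ) : ∃ (q : ℕ) (F : ℕ → ℕ → ℕ), (∀ x z, F x z < q) ∧
    8 * 2 ^ i < q ∧ q ≤ 16 * 2 ^ i ∧
      (∀ x < 2 ^ levelSize i 0, ∀ y < 2 ^ levelSize i 0, x ≠ y → ∀ a,
        ((Finset.range q).filter fun z => F x (a + z) = F y (a + z)).card ≤ 3) ∧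
      ∀ x a c, ((Finset.range q).filter fun z => F x (a + z) = c).card ≤ 4 := by
  obtain ⟨q, hq, hlt, hle⟩ := Nat.exists_prime_lt_and_le_two_mul (8 * 2 ^ i) (by positivity)
  -- Level 0 has exactly (8 * 2 ^ i) ^ 4 colours, few enough to be told apart by cubic polynomials
  -- over a field with more than 8 * 2 ^ i elements.
  obtain ⟨F, hF, hF', hF''⟩ := exists_trial_family (m := 2 ^ levelSize i 0) hq (by
    calc 2 ^ levelSize i 0 = (8 * 2 ^ i) ^ 4 := by
          rw [show 8 = 2 ^ 3 by norm_num, ← pow_add, ← pow_mul, levelSize, towerExp]; congr 1; ring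
      _ ≤ q ^ 4 := Nat.pow_le_pow_left hlt.le 4)
  exact ⟨q, F, hF, hlt, by omega, hF', hF''⟩

theorem exists_lt_two_pow_levelSize (i x : ℕ) : ∃ k, x < 2 ^ levelSize i k := by
  refine ⟨x, lt_of_lt_of_le x.lt_two_pow_self (Nat.pow_le_pow_right (by norm_num) ?_)⟩
  have := le_towerExp i x
  unfold levelSize
  omega

/-- The level at which the identifier `x` starts, for degrees at most `2 ^ i`. -/
noncomputable def startLevel (i x : ℕ) : ℕ := sInf {k | x < 2 ^ levelSize i k}

theorem lt_two_pow_levelSize_startLevel (i x : ℕ) : x < 2 ^ levelSize i (startLevel i x) :=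
  Nat.sInf_mem (s := {k | x < 2 ^ levelSize i k}) (exists_lt_two_pow_levelSize i x)

theorem two_pow_levelSize_le {i x k : ℕ} (h : k < startLevel i x) : 2 ^ levelSize i k ≤ x :=
  not_lt.1 (Nat.notMem_of_lt_sInf (s := {k | x < 2 ^ levelSize i k}) h)

/-- The set in the definition of `logStar` has to be shown nonempty, and it is because n lies below
a tower of n twos. -/
theorem logStar_spec (n : ℕ) : (Real.logb 2)^[logStar n] (n : ℝ) ≤ 1 := by
  refine Nat.sInf_mem (s := {k : ℕ | (Real.logb 2)^[k] (n : ℝ) ≤ 1}) ?_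
  have key : ∀ (k : ℕ) (y : ℝ), y ≤ ((fun z : ℕ => 2 ^ z)^[k] 1 : ℕ) →
      ∃ m, (Real.logb 2)^[m] y ≤ 1 := by
    intro k
    induction k with
    | zero => exact fun y hy => ⟨0, by simpa using hy⟩
    | succ k ih =>
      intro y hy
      by_cases h1 : y ≤ 1
      · exact ⟨0, h1⟩
      · obtain ⟨m, hm⟩ := ih (Real.logb 2 y) (by
          rw [Real.logb_le_iff_le_rpow (by norm_num) (by linarith), Real.rpow_natCast]
          rw [Function.iterate_succ_apply'] at hy
          exact_mod_cast hy)
        exact ⟨m + 1, hm⟩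
  have hle : ∀ k : ℕ, k ≤ (fun z : ℕ => 2 ^ z)^[k] 1 := by
    intro k
    induction k with
    | zero => simp
    | succ k ih =>
      rw [Function.iterate_succ_apply']
      exact lt_of_le_of_lt ih (Nat.lt_two_pow_self)
  exact key n n (by exact_mod_cast hle n)

/-- The slack 4 pays for the reduced exponents: if y ≤ 2 ^ (r + 1), then y + 4 ≤ 2 ^ (r + 3).
Nonpositive y are treated apart, since there `Real.logb` does not invert the exponential. -/
theorem le_towerExp_of_iterate_logb (i L : ℕ) (y : ℝ) (h : (Real.logb 2)^[L] y ≤ 1) :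
    y + 4 ≤ towerExp i L := by
  have h5 : ∀ k, 5 ≤ towerExp i k := fun k => by have := le_towerExp i k; omega
  induction L generalizing y with
  | zero =>
    have : (5 : ℝ) ≤ towerExp i 0 := by exact_mod_cast h5 0
    simp only [Function.iterate_zero, id] at h
    linarith
  | succ L ih =>
    have ih := ih (Real.logb 2 y) h
    have h5' : (5 : ℝ) ≤ towerExp i (L + 1) := by exact_mod_cast h5 (L + 1)
    rcases le_or_gt y 0 with hy | hy
    · linarith
    · obtain ⟨r, hr⟩ : ∃ r, towerExp i L = r + 5 := ⟨_, (Nat.sub_add_cancel (h5 L)).symm⟩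
      have h1 : y ≤ 2 ^ (r + 1) := by
        rw [← Real.rpow_natCast, ← Real.logb_le_iff_le_rpow (by norm_num) hy]
        rw [hr] at ih
        push_cast at ih ⊢
        linarith
      have h2 : (1 : ℝ) ≤ 2 ^ r := one_le_pow₀ (by norm_num)
      rw [towerExp, hr, show r + 5 - 2 = r + 3 by omega]
      push_cast
      rw [pow_succ] at h1
      rw [pow_succ, pow_succ, pow_succ]
      linarith

/-- One more level of the tower at least doubles the bound. -/
theorem mul_le_towerExp (i a L n : ℕ) (h : n + 4 ≤ towerExp i L) :
    2 ^ a * n + 4 ≤ towerExp i (L + a) := by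
  induction a with
  | zero => simpa using h
  | succ a ih =>
    have h5 := le_towerExp i (L + a)
    obtain ⟨r, hr⟩ : ∃ r, towerExp i (L + a) = r + 4 := ⟨_, (Nat.sub_add_cancel (by omega)).symm⟩
    have : r + 1 ≤ 2 ^ r := Nat.lt_two_pow_self
    rw [← add_assoc, towerExp, hr, show r + 4 - 2 = r + 2 by omega, pow_succ, pow_succ, pow_succ,
      show 2 ^ a * 2 * n = 2 * (2 ^ a * n) by ring]
    omega

/-- A polynomially bounded identifier is below 2 ^ (2 ^ (c + 1) * n). The exponent costs log* n
levels for n and c + 1 doublings for the factor. -/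
theorem startLevel_le (c i n x : ℕ) (hn : 2 ≤ n) (hx : x ≤ c * n ^ c) :
    startLevel i x ≤ logStar n + (c + 1) := by
  refine Nat.sInf_le (m := logStar n + (c + 1)) ?_
  have h1 : n + 4 ≤ towerExp i (logStar n) := by
    exact_mod_cast le_towerExp_of_iterate_logb i _ n (logStar_spec n)
  have h2 := mul_le_towerExp i (c + 1) _ n h1
  have h3 : c * n ^ c < 2 ^ (2 ^ (c + 1) * n) := by
    have hc : c < 2 ^ c := Nat.lt_two_pow_self
    have hn' : n ^ c ≤ 2 ^ (n * c) := by
      rw [pow_mul]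
      exact Nat.pow_le_pow_left (Nat.lt_two_pow_self).le c
    calc c * n ^ c < 2 ^ c * 2 ^ (n * c) :=
          Nat.mul_lt_mul_of_lt_of_le hc hn' (by positivity)
      _ = 2 ^ (c + n * c) := (pow_add _ _ _).symm
      _ ≤ _ := by
        refine Nat.pow_le_pow_right (by norm_num) ?_
        calc c + n * c ≤ 2 * (c * n) := by nlinarith
          _ ≤ 2 * (2 ^ c * n) := by gcongr
          _ = _ := by ring
  refine lt_of_le_of_lt hx (h3.trans_le (Nat.pow_le_pow_right (by norm_num) ?_))
  unfold levelSize
  omega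

end Arithmetic

/-! ### The colouring algorithm -/

section ColouringDefs

/-- The modulus of the families of level `k`. -/
noncomputable def levelMod (i k : ℕ) : ℕ := (exists_level_family i k).choose

/-- The functions represented by the colours of level `k + 1`. -/
noncomputable def levelFun (i k : ℕ) : ℕ → ℕ → ℕ := (exists_level_family i k).choose_spec.choose

theorem levelFun_lt (i k x z : ℕ) : levelFun i k x z < levelMod i k :=
  (exists_level_family i k).choose_spec.choose_spec.1 x z

theorem levelMod_mul_self_le (i k : ℕ) : levelMod i k * levelMod i k ≤ 2 ^ levelSize i k :=
  (exists_level_family i k).choose_spec.choose_spec.2.1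

theorem levelFun_separated (i k : ℕ) : ∃ s, 2 ≤ s ∧ 2 ^ i * (s - 1) < levelMod i k ∧
    ∀ x < 2 ^ levelSize i (k + 1), ∀ y < 2 ^ levelSize i (k + 1), x ≠ y →
      ((Finset.range (levelMod i k)).filter
        fun z => levelFun i k x z = levelFun i k y z).card ≤ s - 1 :=
  (exists_level_family i k).choose_spec.choose_spec.2.2

/-- The number of preliminary colours for degrees at most `2 ^ i`. -/
noncomputable def paletteSize (i : ℕ) : ℕ := (exists_palette_family i).choose

/-- The sequence of preliminary colours that a node with a colour of level `0` tries. -/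
noncomputable def trialFun (i : ℕ) : ℕ → ℕ → ℕ := (exists_palette_family i).choose_spec.choose

theorem trialFun_lt (i x z : ℕ) : trialFun i x z < paletteSize i :=
  (exists_palette_family i).choose_spec.choose_spec.1 x z

theorem lt_paletteSize (i : ℕ) : 8 * 2 ^ i < paletteSize i :=
  (exists_palette_family i).choose_spec.choose_spec.2.1

theorem paletteSize_le (i : ℕ) : paletteSize i ≤ 16 * 2 ^ i :=
  (exists_palette_family i).choose_spec.choose_spec.2.2.1

theorem card_trialFun_eq_trialFun_le {i x y : ℕ} (hx : x < 2 ^ levelSize i 0)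
    (hy : y < 2 ^ levelSize i 0) (hxy : x ≠ y) (a : ℕ) :
    ((Finset.range (paletteSize i)).filter
      fun z => trialFun i x (a + z) = trialFun i y (a + z)).card ≤ 3 :=
  (exists_palette_family i).choose_spec.choose_spec.2.2.2.1 x hx y hy hxy a

theorem card_trialFun_eq_le (i x a c : ℕ) :
    ((Finset.range (paletteSize i)).filter fun z => trialFun i x (a + z) = c).card ≤ 4 :=
  (exists_palette_family i).choose_spec.choose_spec.2.2.2.2 x a c

/-- What a node publishes during the computation of the colouring: its identifier, its degree, its
current colour in the reduction of the identifiers, its preliminary colour, and its colour. -/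
structure ColourState where
  ident : ℕ
  deg : ℕ
  lin : ℕ
  fin : Option ℕ
  col : Option ℕ

namespace ColourState

/-- Nodes are grouped by the order of magnitude of their degrees. -/
def scale (s : ColourState) : ℕ := Nat.size s.deg

/-- The number of steps in which the identifier is reduced to a colour of level `0`. -/
noncomputable def level (s : ColourState) : ℕ := startLevel s.scale s.ident

/-- The argument at which the function of the node, a colour of level `k + 1`, differs from the
functions in `N` and avoids the colours of level `k` in `A`. -/
noncomputable def separator (i k x : ℕ) (N A : Set ℕ) : ℕ :=
  sInf {z | z < levelMod i k ∧ (∀ y ∈ N, levelFun i k x z ≠ levelFun i k y z) ∧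
    ∀ a ∈ A, z * levelMod i k + levelFun i k x z ≠ a}

/-- The colour of level `k` that replaces the colour `x` of level `k + 1`. -/
noncomputable def reduce (i k x : ℕ) (N A : Set ℕ) : ℕ :=
  separator i k x N A * levelMod i k + levelFun i k x (separator i k x N A)

/-- Reduction of the colour at time `t`, given the states `M` of the neighbours. -/
noncomputable def nextLin (t : ℕ) (s : ColourState) (M : Set ColourState) : ℕ :=
  if t < s.level then
    reduce s.scale (s.level - t - 1) s.lin
      {y | ∃ m ∈ M, (m.scale = s.scale ∧ m.level = s.level) ∧ m.lin = y}
      {y | ∃ m ∈ M, (m.scale = s.scale ∧ m.level < s.level) ∧ m.lin = y}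
  else s.lin

/-- The preliminary colour tried at time `t`. -/
noncomputable def trial (t : ℕ) (s : ColourState) : ℕ := trialFun s.scale s.lin t

/-- The preliminary colour tried at time `t` is taken or tried by a neighbour. -/
def Conflict (t : ℕ) (s : ColourState) (M : Set ColourState) : Prop :=
  ∃ m ∈ M, m.scale = s.scale ∧ (m.fin = some (s.trial t) ∨
    m.fin = none ∧ m.level ≤ t ∧ m.trial t = s.trial t)

open Classical in
/-- Choice of the preliminary colour. -/
noncomputable def nextFin (t : ℕ) (s : ColourState) (M : Set ColourState) : Option ℕ :=
  if s.fin.isSome ∨ t < s.level then s.fin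
  else if s.Conflict t M then none else some (s.trial t)

/-- The node with state `m` chooses its colour after the one with state `s`. -/
def Later (s m : ColourState) : Prop :=
  s.scale < m.scale ∨ s.scale = m.scale ∧ ∃ a b, s.fin = some a ∧ m.fin = some b ∧ a < b

open Classical in
/-- Choice of the colour: the least colour that no neighbour has, once the earlier neighbours have
chosen. -/
noncomputable def nextCol (s : ColourState) (M : Set ColourState) : Option ℕ :=
  if s.fin.isSome ∧ ∀ m ∈ M, m.col.isSome ∨ s.Later m then
    some (sInf {c | ∀ m ∈ M, m.col ≠ some c}) else none

/-- One round of the computation of the colouring. -/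
noncomputable def step (t : ℕ) (s : ColourState) (M : Set ColourState) : ColourState :=
  if s.col.isSome then s
  else ⟨s.ident, s.deg, s.nextLin t M, s.nextFin t M, s.nextCol M⟩

end ColourState

variable {V : Type} [Fintype V] (G : SimpleGraph V) [DecidableRel G.Adj] (ident : V → ℕ)

/-- The states of the nodes after `t` rounds of the computation of the colouring. -/
noncomputable def colourRun : ℕ → V → ColourState
  | 0 => fun v => ⟨ident v, G.degree v, ident v, none, none⟩
  | t + 1 => fun v => (colourRun t v).step t (colourRun t '' G.neighborSet v)

end ColouringDefs

theorem eq_and_eq_of_mul_add_eq {q a b x y : ℕ} (hx : x < q) (hy : y < q)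
    (h : a * q + x = b * q + y) : a = b ∧ x = y := by
  have h1 := congrArg (· % q) h
  have h2 := congrArg (· / q) h
  have hq : 0 < q := by omega
  simp only [add_comm (_ * q), Nat.add_mul_mod_self_right, Nat.mod_eq_of_lt hx,
    Nat.mod_eq_of_lt hy, Nat.add_mul_div_right _ _ hq, Nat.div_eq_of_lt hx, Nat.div_eq_of_lt hy,
    zero_add] at h1 h2
  exact ⟨h2, h1⟩

/-! ### Reduced identifiers and preliminary colours -/

section ColouringTheory

open ColourState

variable {V : Type} [Fintype V] (G : SimpleGraph V) [DecidableRel G.Adj] (ident : V → ℕ)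

local notation "R" => colourRun G ident

theorem colourRun_succ (t : ℕ) (v : V) : R (t + 1) v =
    if (R t v).col.isSome then R t v
    else ⟨(R t v).ident, (R t v).deg, (R t v).nextLin t (R t '' G.neighborSet v),
      (R t v).nextFin t (R t '' G.neighborSet v), (R t v).nextCol (R t '' G.neighborSet v)⟩ := rfl

@[simp] theorem colourRun_ident (t : ℕ) (v : V) : (R t v).ident = ident v := by
  induction t with
  | zero => rfl
  | succ t ih => rw [colourRun_succ]; split_ifs <;> exact ih

@[simp] theorem colourRun_deg (t : ℕ) (v : V) : (R t v).deg = G.degree v := by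
  induction t with
  | zero => rfl
  | succ t ih => rw [colourRun_succ]; split_ifs <;> exact ih

/-- The scale of a node. -/
def nodeScale (v : V) : ℕ := Nat.size (G.degree v)

/-- The level at which a node starts. -/
noncomputable def nodeLevel (v : V) : ℕ := startLevel (nodeScale G v) (ident v)

local notation "sc" => nodeScale G
local notation "lv" => nodeLevel G ident

@[simp] theorem colourRun_scale (t : ℕ) (v : V) : (R t v).scale = sc v := by
  rw [scale, colourRun_deg, nodeScale]

@[simp] theorem colourRun_level (t : ℕ) (v : V) : (R t v).level = lv v := by
  rw [level, colourRun_scale, colourRun_ident, nodeLevel]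

theorem degree_lt_two_pow (v : V) : G.degree v < 2 ^ sc v := Nat.lt_size_self _

theorem colourRun_fin_succ (t : ℕ) (v : V) : (R (t + 1) v).fin =
    if (R t v).col.isSome then (R t v).fin
    else (R t v).nextFin t (R t '' G.neighborSet v) := by
  rw [colourRun_succ]; split_ifs <;> rfl

theorem colourRun_col_succ (t : ℕ) (v : V) : (R (t + 1) v).col =
    if (R t v).col.isSome then (R t v).col else (R t v).nextCol (R t '' G.neighborSet v) := by
  rw [colourRun_succ]; split_ifs <;> rfl

theorem colourRun_fin_succ_eq {t : ℕ} {v : V} {a : ℕ} (h : (R t v).fin = some a) :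
    (R (t + 1) v).fin = some a := by
  rw [colourRun_fin_succ, nextFin, h]
  simp

theorem colourRun_col_succ_eq {t : ℕ} {v : V} {a : ℕ} (h : (R t v).col = some a) :
    (R (t + 1) v).col = some a := by
  rw [colourRun_col_succ, h]
  simp

theorem colourRun_fin_mono {t t' : ℕ} (htt : t ≤ t') {v : V} {a : ℕ} (h : (R t v).fin = some a) :
    (R t' v).fin = some a := by
  induction htt with
  | refl => exact h
  | step _ ih => exact colourRun_fin_succ_eq G ident ih

theorem colourRun_col_mono {t t' : ℕ} (htt : t ≤ t') {v : V} {a : ℕ} (h : (R t v).col = some a) :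
    (R t' v).col = some a := by
  induction htt with
  | refl => exact h
  | step _ ih => exact colourRun_col_succ_eq G ident ih

theorem colourRun_col_unique {t t' : ℕ} {v : V} {a a' : ℕ} (h : (R t v).col = some a)
    (h' : (R t' v).col = some a') : a = a' := by
  have := colourRun_col_mono G ident (le_max_left t t') h
  rw [colourRun_col_mono G ident (le_max_right t t') h'] at this
  exact (Option.some.inj this).symm

theorem colourRun_eq_of_col {t t' : ℕ} (htt : t ≤ t') {v : V} (h : (R t v).col.isSome) :
    R t' v = R t v := by
  induction htt with
  | refl => rfl
  | step _ ih => rw [colourRun_succ, if_pos (by rwa [ih]), ih]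

/-- Trials begin only after the node has finished its reduction. Freezing a coloured node therefore
never interrupts its reduction. -/
theorem level_le_of_fin {t : ℕ} {v : V} (h : (R t v).fin.isSome) : lv v ≤ t := by
  induction t with
  | zero => simp [colourRun] at h
  | succ t ih =>
    by_cases hf : (R t v).fin.isSome
    · exact (ih hf).trans t.le_succ
    · rw [colourRun_fin_succ, nextFin, colourRun_level] at h
      by_contra hlt
      simp only [show t < lv v by omega, or_true, if_true, ite_self] at h
      exact hf h

theorem fin_isSome_of_col {t : ℕ} {v : V} (h : (R t v).col.isSome) : (R t v).fin.isSome := by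
  induction t with
  | zero => simp [colourRun] at h
  | succ t ih =>
    have key : (R t v).fin.isSome := by
      by_cases hc : (R t v).col.isSome
      · exact ih hc
      · rw [colourRun_col_succ, if_neg hc, nextCol] at h
        by_contra hf
        simp [hf] at h
    obtain ⟨a, ha⟩ := Option.isSome_iff_exists.1 key
    rw [colourRun_fin_succ_eq G ident ha]
    rfl

theorem colourRun_lin_succ (t : ℕ) (v : V) : (R (t + 1) v).lin =
    if t < lv v then
      reduce (sc v) (lv v - t - 1) (R t v).lin
        {y | ∃ u, G.Adj v u ∧ (sc u = sc v ∧ lv u = lv v) ∧ (R t u).lin = y}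
        {y | ∃ u, G.Adj v u ∧ (sc u = sc v ∧ lv u < lv v) ∧ (R t u).lin = y}
    else (R t v).lin := by
  by_cases hc : (R t v).col.isSome
  · rw [colourRun_succ, if_pos hc, if_neg]
    exact not_lt.2 (level_le_of_fin G ident (fin_isSome_of_col G ident hc))
  · rw [colourRun_succ, if_neg hc]
    simp only [nextLin, colourRun_scale, colourRun_level, Set.exists_mem_image,
      SimpleGraph.mem_neighborSet]

theorem colourRun_lin_eq {t : ℕ} {v : V} (h : lv v ≤ t) : (R t v).lin = (R (lv v) v).lin := by
  induction h with
  | refl => rfl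
  | @step m h ih => rw [colourRun_lin_succ, if_neg (not_lt.2 h), ih]

/-- Each of the at most 2 ^ i neighbours spoils at most s - 1 arguments: one of the same level
because two polynomials agree rarely, one of lower level because its colour names a single point. As
2 ^ i * (s - 1) < q, some argument remains. -/
theorem separator_spec (i k x : ℕ) (hx : x < 2 ^ levelSize i (k + 1)) (T : Finset V)
    (hT : T.card ≤ 2 ^ i) (l : V → ℕ) (P Q : V → Prop) (hPQ : ∀ u ∈ T, P u → ¬ Q u)
    (hl : ∀ u ∈ T, P u → l u < 2 ^ levelSize i (k + 1) ∧ l u ≠ x) :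
    let z := separator i k x {y | ∃ u, u ∈ T ∧ P u ∧ l u = y} {y | ∃ u, u ∈ T ∧ Q u ∧ l u = y}
    z < levelMod i k ∧ (∀ u ∈ T, P u → levelFun i k x z ≠ levelFun i k (l u) z) ∧
      ∀ u ∈ T, Q u → z * levelMod i k + levelFun i k x z ≠ l u := by
  classical
  obtain ⟨s, hs, hq, hsep⟩ := levelFun_separated i k
  let bad : V → Finset ℕ := fun u => (Finset.range (levelMod i k)).filter fun z =>
    (P u ∧ levelFun i k x z = levelFun i k (l u) z) ∨
      (Q u ∧ z * levelMod i k + levelFun i k x z = l u)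
  have hbad : ∀ u ∈ T, (bad u).card ≤ s - 1 := by
    intro u hu
    by_cases hP : P u
    · refine le_trans (Finset.card_le_card fun z hz => ?_)
        (hsep x hx (l u) (hl u hu hP).1 (hl u hu hP).2.symm)
      simpa [bad, hP, hPQ u hu hP] using hz
    · refine le_trans (Finset.card_le_one.2 fun z hz z' hz' => ?_) (by omega : 1 ≤ s - 1)
      simp only [bad, hP, false_and, false_or, Finset.mem_filter] at hz hz'
      -- The forbidden colour encodes a pair in base q and thus determines z. This costs one
      -- argument, within s - 1 because s ≥ 2.
      have h : z * levelMod i k + levelFun i k x z = z' * levelMod i k + levelFun i k x z' :=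
        hz.2.2.trans hz'.2.2.symm
      exact (eq_and_eq_of_mul_add_eq (levelFun_lt i k x z) (levelFun_lt i k x z') h).1
  have hcard : (T.biUnion bad).card < (Finset.range (levelMod i k)).card := by
    rw [Finset.card_range]
    exact lt_of_le_of_lt (Finset.card_biUnion_le_card_mul _ _ _ hbad)
      (lt_of_le_of_lt (Nat.mul_le_mul_right _ hT) hq)
  obtain ⟨z, hz, hz'⟩ := Finset.exists_mem_notMem_of_card_lt_card hcard
  have hne : {z | z < levelMod i k ∧ (∀ y ∈ {y | ∃ u, u ∈ T ∧ P u ∧ l u = y},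
      levelFun i k x z ≠ levelFun i k y z) ∧
      ∀ a ∈ {y | ∃ u, u ∈ T ∧ Q u ∧ l u = y}, z * levelMod i k + levelFun i k x z ≠ a}.Nonempty := by
    refine ⟨z, Finset.mem_range.1 hz, ?_, ?_⟩
    · rintro _ ⟨u, hu, hP, rfl⟩ h
      exact hz' (Finset.mem_biUnion.2 ⟨u, hu, Finset.mem_filter.2 ⟨hz, Or.inl ⟨hP, h⟩⟩⟩)
    · rintro _ ⟨u, hu, hQ, rfl⟩ h
      exact hz' (Finset.mem_biUnion.2 ⟨u, hu, Finset.mem_filter.2 ⟨hz, Or.inr ⟨hQ, h⟩⟩⟩)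
  obtain ⟨h1, h2, h3⟩ := Nat.sInf_mem hne
  exact ⟨h1, fun u hu hP => h2 _ ⟨u, hu, hP, rfl⟩, fun u hu hQ => h3 _ ⟨u, hu, hQ, rfl⟩⟩

/-- The reduced identifiers of neighbouring nodes of the same scale and level are distinct, and they
also differ from the final ones of lower level. -/
theorem colourRun_lin_spec (hid : Function.Injective ident) (t : ℕ) :
    (∀ v, (R t v).lin < 2 ^ levelSize (sc v) (lv v - t)) ∧
    ∀ u v, G.Adj u v → sc u = sc v → (lv u = lv v ∨ lv u < lv v ∧ lv v ≤ t) →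
      (R t u).lin ≠ (R t v).lin := by
  induction t with
  | zero =>
    exact ⟨fun v => lt_two_pow_levelSize_startLevel _ _, fun u v huv _ _ h => huv.ne (hid h)⟩
  | succ t ih =>
    obtain ⟨hlt, hne⟩ := ih
    have hstep : ∀ v, t < lv v → ∃ z, z < levelMod (sc v) (lv v - t - 1) ∧
        (R (t + 1) v).lin = z * levelMod (sc v) (lv v - t - 1) +
          levelFun (sc v) (lv v - t - 1) (R t v).lin z ∧
        (∀ u, G.Adj v u → sc u = sc v → lv u = lv v →
          levelFun (sc v) (lv v - t - 1) (R t v).lin z ≠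
            levelFun (sc v) (lv v - t - 1) (R t u).lin z) ∧
        ∀ u, G.Adj v u → sc u = sc v → lv u < lv v → (R (t + 1) v).lin ≠ (R t u).lin := by
      intro v hv
      have hk : lv v - t - 1 + 1 = lv v - t := by omega
      have := separator_spec (sc v) (lv v - t - 1) (R t v).lin (by rw [hk]; exact hlt v)
        (G.neighborFinset v)
        ((G.card_neighborFinset_eq_degree v).trans_le (degree_lt_two_pow G v).le)
        (fun u => (R t u).lin) (fun u => sc u = sc v ∧ lv u = lv v)
        (fun u => sc u = sc v ∧ lv u < lv v) (fun u _ h h' => h'.2.ne h.2) (fun u hu h => by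
          rw [SimpleGraph.mem_neighborFinset] at hu
          refine ⟨?_, (hne v u hu h.1.symm (Or.inl h.2.symm)).symm⟩
          rw [hk, ← h.1, ← h.2]
          exact hlt u)
      simp only [SimpleGraph.mem_neighborFinset] at this
      obtain ⟨h1, h2, h3⟩ := this
      rw [colourRun_lin_succ, if_pos hv]
      exact ⟨_, h1, rfl, fun u hu hs hl => h2 u hu ⟨hs, hl⟩, fun u hu hs hl => h3 u hu ⟨hs, hl⟩⟩
    have hold : ∀ v, lv v ≤ t → (R (t + 1) v).lin = (R t v).lin := fun v hv => by
      rw [colourRun_lin_succ, if_neg (not_lt.2 hv)]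
    refine ⟨fun v => ?_, fun u v huv hs hl => ?_⟩
    · rcases lt_or_ge t (lv v) with hv | hv
      · obtain ⟨z, hz, h, -⟩ := hstep v hv
        rw [h, ← Nat.sub_sub]
        refine lt_of_lt_of_le ?_ (levelMod_mul_self_le _ _)
        have := levelFun_lt (sc v) (lv v - t - 1) (R t v).lin z
        nlinarith
      · rw [hold v hv]
        have := hlt v
        rwa [Nat.sub_eq_zero_of_le hv, ← Nat.sub_eq_zero_of_le (hv.trans t.le_succ)] at this
    · rcases hl with hl | ⟨hl, hv⟩
      · rcases lt_or_ge t (lv v) with hv | hv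
        · obtain ⟨z, hz, h, hF, -⟩ := hstep v hv
          obtain ⟨z', hz', h', -, -⟩ := hstep u (hl ▸ hv)
          rw [hs, hl] at h' hz'
          intro heq
          rw [h, h'] at heq
          obtain ⟨rfl, heq⟩ := eq_and_eq_of_mul_add_eq (levelFun_lt _ _ _ _) (levelFun_lt _ _ _ _) heq
          exact hF u huv.symm hs hl heq.symm
        · rw [hold u (hl ▸ hv), hold v hv]
          exact hne u v huv hs (Or.inl hl)
      -- The level of v is at most t + 1. If it exceeds t, this is the last reduction of v, while u
      -- already has its final colour, which v avoids.
      · rcases lt_or_ge t (lv v) with hv' | hv'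
        · obtain ⟨z, hz, h, -, hA⟩ := hstep v hv'
          rw [hold u (by omega)]
          exact (hA u huv.symm hs hl).symm
        · rw [hold u (by omega), hold v hv']
          exact hne u v huv hs (Or.inr ⟨hl, hv'⟩)

/-- For the message length: a node starts at the lowest level containing its identifier, so all
colours of the lower levels it passes through are smaller than the identifier. -/
theorem colourRun_lin_le_ident (hid : Function.Injective ident) (t : ℕ) (v : V) :
    (R t v).lin ≤ ident v := by
  rcases Nat.eq_zero_or_pos t with rfl | ht
  · exact le_rfl
  · rcases Nat.eq_zero_or_pos (lv v) with h | h
    · rw [colourRun_lin_eq G ident (h.trans_le (Nat.zero_le t)), h]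
      exact le_rfl
    · exact ((colourRun_lin_spec G ident hid t).1 v).le.trans
        (two_pow_levelSize_le (show lv v - t < lv v by omega))

/-- The reduced identifier of a node. -/
noncomputable def reducedIdent (v : V) : ℕ := (R (lv v) v).lin

local notation "ri" => reducedIdent G ident

theorem reducedIdent_lt (hid : Function.Injective ident) (v : V) :
    ri v < 2 ^ levelSize (sc v) 0 := by
  have := (colourRun_lin_spec G ident hid (lv v)).1 v
  rwa [Nat.sub_self] at this

theorem reducedIdent_ne (hid : Function.Injective ident) {u v : V} (h : G.Adj u v)
    (hs : sc u = sc v) : ri u ≠ ri v := by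
  wlog hl : lv u ≤ lv v generalizing u v
  · exact (this h.symm hs.symm (le_of_not_ge hl)).symm
  · have := (colourRun_lin_spec G ident hid (lv v)).2 u v h hs
      (hl.eq_or_lt.imp id fun h => ⟨h, le_rfl⟩)
    rwa [colourRun_lin_eq G ident hl] at this

theorem colourRun_trial {t : ℕ} {v : V} (h : lv v ≤ t) :
    (R t v).trial t = trialFun (sc v) (ri v) t := by
  rw [trial, colourRun_scale, colourRun_lin_eq G ident h, reducedIdent]

theorem conflict_iff {t : ℕ} {v : V} (h : lv v ≤ t) :
    (R t v).Conflict t (R t '' G.neighborSet v) ↔ ∃ u, G.Adj v u ∧ sc u = sc v ∧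
      ((R t u).fin = some (trialFun (sc v) (ri v) t) ∨ (R t u).fin = none ∧ lv u ≤ t ∧
        trialFun (sc v) (ri u) t = trialFun (sc v) (ri v) t) := by
  simp only [Conflict, Set.exists_mem_image, SimpleGraph.mem_neighborSet, colourRun_scale,
    colourRun_level, colourRun_trial G ident h]
  refine exists_congr fun u => and_congr_right fun _ => and_congr_right fun hs =>
    or_congr_right (and_congr_right fun _ => and_congr_right fun hu => ?_)
  rw [colourRun_trial G ident hu, hs]

theorem colourRun_fin_succ_of_none {t : ℕ} {v : V} {a : ℕ} (h : (R t v).fin = none)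
    (h' : (R (t + 1) v).fin = some a) : lv v ≤ t ∧ a = trialFun (sc v) (ri v) t ∧
      ¬ (R t v).Conflict t (R t '' G.neighborSet v) := by
  have hc : ¬ (R t v).col.isSome := fun hc => by
    have := fin_isSome_of_col G ident hc
    simp [h] at this
  rw [colourRun_fin_succ, if_neg hc, nextFin, h, colourRun_level] at h'
  have hl : ¬ t < lv v := fun hl => by simp [hl] at h'
  have hl' := not_lt.1 hl
  rw [if_neg (by simpa using hl')] at h'
  split_ifs at h' with hcon
  rw [colourRun_trial G ident hl'] at h'
  exact ⟨hl', (Option.some.inj h').symm, hcon⟩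

theorem colourRun_fin_lt {t : ℕ} {v : V} {a : ℕ} (h : (R t v).fin = some a) :
    a < paletteSize (sc v) := by
  induction t with
  | zero => simp [colourRun] at h
  | succ t ih =>
    rcases hf : (R t v).fin with _ | b
    · rw [(colourRun_fin_succ_of_none G ident hf h).2.1]
      exact trialFun_lt _ _ _
    · rw [colourRun_fin_succ_eq G ident hf] at h
      exact ih (hf.trans h)

/-- A node sees both the colours already fixed and the trials of the current round, so it cannot
repeat an earlier choice, and two equal simultaneous trials both fail. -/
theorem colourRun_fin_ne {t : ℕ} {u v : V} {a : ℕ} (huv : G.Adj u v) (hs : sc u = sc v)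
    (hu : (R t u).fin = some a) : (R t v).fin ≠ some a := by
  induction t generalizing u v a with
  | zero => simp [colourRun] at hu
  | succ t ih =>
    intro hv
    wlog hf : (R t v).fin = none generalizing u v
    · rcases hf' : (R t u).fin with _ | b
      · exact this huv.symm hs.symm hv hu hf'
      · obtain ⟨c, hc⟩ := Option.ne_none_iff_exists'.1 hf
        rw [colourRun_fin_succ_eq G ident hc] at hv
        rw [colourRun_fin_succ_eq G ident hf'] at hu
        exact ih huv hs (hf'.trans hu) (hc.trans hv)
    · obtain ⟨hl, rfl, hcon⟩ := colourRun_fin_succ_of_none G ident hf hv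
      rw [conflict_iff G ident hl] at hcon
      refine hcon ⟨u, huv.symm, hs, ?_⟩
      rcases hf' : (R t u).fin with _ | b
      · obtain ⟨hl', heq, -⟩ := colourRun_fin_succ_of_none G ident hf' hu
        exact Or.inr ⟨rfl, hl', by rw [heq, hs]⟩
      · rw [colourRun_fin_succ_eq G ident hf'] at hu
        exact Or.inl hu

/-- During one period a neighbour spoils at most 4 trials by the colour it has fixed and at most 3
by its own trials. Since 7 * deg v < 8 * 2 ^ i < q, some trial succeeds. -/
theorem exists_fin (hid : Function.Injective ident) (v : V) :
    ((R (lv v + paletteSize (sc v)) v).fin).isSome := by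
  classical
  by_contra hnone
  have hnone' : ∀ z ≤ paletteSize (sc v), (R (lv v + z) v).fin = none := by
    intro z hz
    by_contra h
    obtain ⟨a, ha⟩ := Option.ne_none_iff_exists'.1 h
    rw [colourRun_fin_mono G ident (by omega) ha] at hnone
    exact hnone rfl
  -- A colour once fixed never changes, so its value at the end of the period serves for all
  -- conflicts. The default 0 merely enlarges the set of bad times.
  let c : V → ℕ := fun u => ((R (lv v + paletteSize (sc v)) u).fin).getD 0
  let bad : V → Finset ℕ := fun u => if sc u = sc v then
    ((Finset.range (paletteSize (sc v))).filter
      fun z => trialFun (sc v) (ri v) (lv v + z) = c u) ∪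
    ((Finset.range (paletteSize (sc v))).filter
      fun z => trialFun (sc v) (ri u) (lv v + z) = trialFun (sc v) (ri v) (lv v + z)) else ∅
  have hbad : ∀ u ∈ G.neighborFinset v, (bad u).card ≤ 7 := by
    intro u hu
    rw [SimpleGraph.mem_neighborFinset] at hu
    by_cases hs : sc u = sc v
    · simp only [bad, hs, if_true]
      refine (Finset.card_union_le _ _).trans (add_le_add (card_trialFun_eq_le _ _ _ _)
        (card_trialFun_eq_trialFun_le ?_ (reducedIdent_lt G ident hid v)
          (reducedIdent_ne G ident hid hu.symm hs) _) : _ ≤ 4 + 3)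
      rw [← hs]
      exact reducedIdent_lt G ident hid u
    · simp [bad, hs]
  have hcover : Finset.range (paletteSize (sc v)) ⊆ (G.neighborFinset v).biUnion bad := by
    intro z hz
    have hzlt := Finset.mem_range.1 hz
    have hcon : (R (lv v + z) v).Conflict (lv v + z) (R (lv v + z) '' G.neighborSet v) := by
      by_contra hcon
      have h0 := hnone' z hzlt.le
      have h1 := hnone' (z + 1) hzlt
      rw [← add_assoc, colourRun_fin_succ] at h1
      have hc : ¬ (R (lv v + z) v).col.isSome := fun hc => by
        have := fin_isSome_of_col G ident hc
        simp [h0] at this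
      rw [if_neg hc, nextFin, h0, colourRun_level, if_neg (by simp), if_neg hcon] at h1
      simp at h1
    obtain ⟨u, hvu, hs, h⟩ := (conflict_iff G ident (by omega)).1 hcon
    refine Finset.mem_biUnion.2 ⟨u, (G.mem_neighborFinset v u).2 hvu, ?_⟩
    simp only [bad, hs, if_true, Finset.mem_union, Finset.mem_filter]
    rcases h with h | ⟨-, -, h⟩
    · left
      refine ⟨hz, ?_⟩
      have := colourRun_fin_mono G ident (t' := lv v + paletteSize (sc v)) (by omega) h
      simp [c, this]
    · exact Or.inr ⟨hz, h⟩
  have h1 := Finset.card_le_card hcover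
  have h2 := Finset.card_biUnion_le_card_mul _ _ _ hbad
  rw [Finset.card_range] at h1
  rw [G.card_neighborFinset_eq_degree] at h2
  have h3 := degree_lt_two_pow G v
  have h4 := lt_paletteSize (sc v)
  omega

end ColouringTheory

/-! ### The final colouring with Δ + 1 colours -/

section ColouringResult

open ColourState

variable {V : Type} [Fintype V] (G : SimpleGraph V) [DecidableRel G.Adj] (ident : V → ℕ)

local notation "R" => colourRun G ident
local notation "sc" => nodeScale G
local notation "lv" => nodeLevel G ident

theorem sInf_compl_le_card (F : Finset ℕ) : sInf {c | c ∉ F} ∉ F ∧ sInf {c | c ∉ F} ≤ F.card := by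
  obtain ⟨c, hc, hcF⟩ := Finset.exists_mem_notMem_of_card_lt_card
    (show F.card < (Finset.range (F.card + 1)).card by simp)
  refine ⟨Nat.sInf_mem (s := {c | c ∉ F}) ⟨c, hcF⟩, (Nat.sInf_le (show c ∈ {c | c ∉ F} from hcF)).trans ?_⟩
  rw [Finset.mem_range] at hc
  omega

theorem colourRun_col_succ_of_none {t : ℕ} {v : V} {a : ℕ} (h : (R t v).col = none)
    (h' : (R (t + 1) v).col = some a) :
    (∀ u, G.Adj v u → (R t u).col.isSome ∨ (R t v).Later (R t u)) ∧
      (∀ u, G.Adj v u → (R t u).col ≠ some a) ∧ a ≤ G.degree v := by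
  classical
  rw [colourRun_col_succ, h, if_neg (by simp), nextCol] at h'
  split_ifs at h' with hcond
  simp only [Set.forall_mem_image, SimpleGraph.mem_neighborSet] at hcond h'
  let F : Finset ℕ := (G.neighborFinset v).biUnion fun u => (R t u).col.toFinset
  have hF : ∀ c, c ∈ F ↔ ∃ u, G.Adj v u ∧ (R t u).col = some c := fun c => by
    simp [F, Option.mem_def]
  have hset : {c | ∀ ⦃u⦄, G.Adj v u → (R t u).col ≠ some c} = {c | c ∉ F} := by
    ext c
    simp only [Set.mem_ofPred_eq, hF]
    push Not
    rfl
  obtain ⟨h1, h2⟩ := sInf_compl_le_card F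
  rw [hset] at h'
  obtain rfl := Option.some.inj h'
  refine ⟨fun u hu => hcond.2 hu, fun u hu hcol => h1 ((hF _).2 ⟨u, hu, hcol⟩), h2.trans ?_⟩
  refine (Finset.card_biUnion_le_card_mul _ _ 1 fun u _ => ?_).trans ?_
  · rw [Option.card_toFinset]
    cases (R t u).col <;> simp
  · rw [mul_one, G.card_neighborFinset_eq_degree]

theorem colourRun_col_le_degree {t : ℕ} {v : V} {a : ℕ} (h : (R t v).col = some a) :
    a ≤ G.degree v := by
  induction t with
  | zero => simp [colourRun] at h
  | succ t ih =>
    rcases hc : (R t v).col with _ | b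
    · exact (colourRun_col_succ_of_none G ident hc h).2.2
    · rw [colourRun_col_succ_eq G ident hc] at h
      exact ih (hc.trans h)

theorem Later.asymm {s m : ColourState} (h : s.Later m) : ¬ m.Later s := by
  rintro (h' | ⟨hs, a, b, ha, hb, hab⟩)
  · rcases h with h | ⟨h, -⟩ <;> omega
  · rcases h with h | ⟨-, a', b', ha', hb', hab'⟩
    · omega
    · rw [ha] at hb'
      rw [hb] at ha'
      simp only [Option.some.injEq] at ha' hb'
      omega

/-- Two neighbours cannot choose in the same round, since each would have to be later than the
other. One that chooses afterwards sees the colour of the first. -/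
theorem colourRun_col_ne {t : ℕ} {u v : V} {a : ℕ} (huv : G.Adj u v)
    (hu : (R t u).col = some a) : (R t v).col ≠ some a := by
  induction t generalizing u v a with
  | zero => simp [colourRun] at hu
  | succ t ih =>
    intro hv
    wlog hf : (R t v).col = none generalizing u v
    · rcases hf' : (R t u).col with _ | b
      · exact this huv.symm hv hu hf'
      · obtain ⟨c, hc⟩ := Option.ne_none_iff_exists'.1 hf
        rw [colourRun_col_succ_eq G ident hc] at hv
        rw [colourRun_col_succ_eq G ident hf'] at hu
        exact ih huv (hf'.trans hu) (hc.trans hv)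
    · obtain ⟨hlater, hne, -⟩ := colourRun_col_succ_of_none G ident hf hv
      rcases hf' : (R t u).col with _ | b
      · obtain ⟨hlater', -, -⟩ := colourRun_col_succ_of_none G ident hf' hu
        refine Later.asymm ((hlater u huv.symm).resolve_left (by simp [hf'])) ?_
        exact (hlater' v huv).resolve_left (by simp [hf])
      · rw [colourRun_col_succ_eq G ident hf'] at hu
        exact hne u huv.symm (hf'.trans hu)

/-- The nodes choose their colours in the order of their scales and preliminary colours. -/
theorem col_isSome_of_fin {T : ℕ} (hT : ∀ v, (R T v).fin.isSome) (r : ℕ) :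
    ∀ v a, (R T v).fin = some a → 16 * 2 ^ sc v + a ≤ r → (R (T + r + 1) v).col.isSome := by
  induction r using Nat.strong_induction_on with
  | _ r ih =>
    intro v a hv hr
    rw [colourRun_col_succ]
    split_ifs with hc
    · exact hc
    · rw [nextCol, if_pos]
      · rfl
      · refine ⟨by rw [colourRun_fin_mono G ident (Nat.le_add_right T r) hv]; rfl, ?_⟩
        rintro _ ⟨u, hu : G.Adj v u, rfl⟩
        obtain ⟨b, hb⟩ := Option.isSome_iff_exists.1 (hT u)
        have hbl := colourRun_fin_lt G ident hb
        have hbp := paletteSize_le (sc u)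
        have hfu := colourRun_fin_mono G ident (Nat.le_add_right T r) hb
        have hfv := colourRun_fin_mono G ident (Nat.le_add_right T r) hv
        -- Preliminary colours are below 16 * 2 ^ sc, so 16 * 2 ^ sc + colour lies in [16 * 2 ^ sc,
        -- 32 * 2 ^ sc). These intervals are disjoint for different scales, hence this number orders
        -- the nodes lexicographically.
        have hcol : 16 * 2 ^ sc u + b < 16 * 2 ^ sc v + a → (R (T + r) u).col.isSome := by
          intro hlt
          have := ih (16 * 2 ^ sc u + b) (by omega) u b hb le_rfl
          rwa [colourRun_eq_of_col G ident (t' := T + r) (by omega) this]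
        rcases lt_trichotomy (sc v) (sc u) with h | h | h
        · exact Or.inr (Or.inl (by simpa using h))
        · rcases lt_trichotomy a b with h' | h' | h'
          · exact Or.inr (Or.inr ⟨by simpa using h, a, b, hfv, hfu, h'⟩)
          · exact absurd (h' ▸ hb) (colourRun_fin_ne G ident hu h hv)
          · exact Or.inl (hcol (by rw [h]; omega))
        · refine Or.inl (hcol ?_)
          have : 2 ^ (sc u + 1) ≤ 2 ^ sc v := Nat.pow_le_pow_right (by norm_num) h
          rw [pow_succ] at this
          omega

/-- The algorithm computes a proper colouring with `Δ + 1` colours. -/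
theorem exists_coloring (hid : Function.Injective ident) {J B : ℕ} (hJ : ∀ v, lv v ≤ J)
    (hB : ∀ v, 2 ^ sc v ≤ B) : ∃ φ : G.Coloring (Fin (G.maxDegree + 1)),
      (∀ t v a, (R t v).col = some a → a = (φ v : ℕ)) ∧
      ∀ t, J + 48 * B + 1 ≤ t → ∀ v, (R t v).col = some (φ v : ℕ) := by
  -- `J` rounds suffice for the reductions and 16 * `B` for one period of trials. The final phase
  -- takes 32 * `B` more, a bound for 16 * 2 ^ sc + colour.
  have hfin : ∀ v, (R (J + 16 * B) v).fin.isSome := by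
    intro v
    obtain ⟨a, ha⟩ := Option.isSome_iff_exists.1 (exists_fin G ident hid v)
    have h1 := paletteSize_le (sc v)
    have h2 := hB v
    have h3 := hJ v
    rw [colourRun_fin_mono G ident (by omega) ha]
    rfl
  have hcol : ∀ v, ∃ a, (R (J + 48 * B + 1) v).col = some a := by
    intro v
    obtain ⟨a, ha⟩ := Option.isSome_iff_exists.1 (hfin v)
    have h1 := paletteSize_le (sc v)
    have h2 := hB v
    have h4 := colourRun_fin_lt G ident ha
    rw [← Option.isSome_iff_exists, show J + 48 * B + 1 = J + 16 * B + 32 * B + 1 by ring]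
    exact col_isSome_of_fin G ident hfin (32 * B) v a ha (by omega)
  choose c hc using hcol
  have hlt : ∀ v, c v < G.maxDegree + 1 := fun v =>
    Nat.lt_succ_of_le ((colourRun_col_le_degree G ident (hc v)).trans (G.degree_le_maxDegree v))
  refine ⟨SimpleGraph.Coloring.mk (fun v => ⟨c v, hlt v⟩) fun {u v} huv h => ?_,
    fun t v a h => colourRun_col_unique G ident h (hc v),
    fun t ht v => colourRun_col_mono G ident ht (hc v)⟩
  refine colourRun_col_ne G ident huv (hc u) ?_
  rw [hc v, ← Fin.mk.inj h]

end ColouringResult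

/-! ### The auction as message passing -/

section NetworkDefs

/-- What a node publishes in a round: its state in the computation of the colouring, one bit of its
bid, whether it is selected, whether two selected neighbours are above it, and whether it knows its
price. -/
structure Public where
  colour : ColourState
  bit : Bool
  sel : Option Bool
  multi : Option Bool
  done : Bool

/-- What is inferred from silence: the neighbour has stopped. -/
def Public.silent : Public := ⟨⟨0, 0, 0, none, none⟩, false, none, none, true⟩

/-- The state of a node. -/
structure NodeState where
  clock : ℕ
  maxWeight : ℕ
  bid : ℕ
  colour : ColourState
  /-- the part of the bids of the neighbours received so far -/
  nbrBid : ℕ → ℕ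
  sel : Option Bool
  multi : Option Bool
  price : Option ℕ
  halted : Bool

namespace NodeState

/-- The published part of a state. -/
def toPublic (s : NodeState) : Public :=
  ⟨s.colour, s.bid.testBit s.clock, s.sel, s.multi, s.price.isSome⟩

/-- The initial state. -/
def initial (maxWeight ident bid degree : ℕ) : NodeState :=
  ⟨0, maxWeight, bid, ⟨ident, degree, ident, none, none⟩, fun _ => 0, none, none, none, false⟩

/-- The neighbour at port `p` is above the node. -/
def PortAbove (s : NodeState) (m : ℕ → Public) (p : ℕ) : Prop :=
  s.bid < s.nbrBid p ∨
    s.bid = s.nbrBid p ∧ (m p).colour.col.getD 0 < s.colour.col.getD 0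

open Classical in
/-- A node decides once all neighbours above it have decided. -/
noncomputable def nextSel (s : NodeState) (m : ℕ → Public) : Option Bool :=
  if s.sel.isSome then s.sel
  else if s.maxWeight.size ≤ s.clock ∧ s.colour.col.isSome ∧ ∀ p < s.colour.deg,
      (m p).colour.col.isSome ∧ (s.PortAbove m p → (m p).sel.isSome) then
    some (decide (∀ p < s.colour.deg, s.PortAbove m p → (m p).sel = some false))
  else none

open Classical in
/-- Are there two selected neighbours above the node? -/
noncomputable def nextMulti (s : NodeState) (m : ℕ → Public) : Option Bool :=
  if s.multi.isSome then s.multi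
  else if s.sel.isSome ∧ ∀ p < s.colour.deg, (m p).sel.isSome then
    some (decide (∃ p < s.colour.deg, ∃ p' < s.colour.deg, p ≠ p' ∧
      (s.PortAbove m p ∧ (m p).sel = some true) ∧ s.PortAbove m p' ∧ (m p').sel = some true))
  else none

open Classical in
/-- The price of a node if it is selected. -/
noncomputable def nextPrice (s : NodeState) (m : ℕ → Public) : Option ℕ :=
  if s.multi.isSome ∧ ∀ p < s.colour.deg, (m p).multi.isSome then
    some ((Finset.range s.colour.deg).sup fun p =>
      if ¬ s.PortAbove m p ∧ (m p).multi = some false then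
        if s.colour.col.getD 0 < (m p).colour.col.getD 0 then s.nbrBid p else s.nbrBid p + 1
      else 0)
  else none

/-- Reception of one bit of each bid. -/
def nextNbrBid (s : NodeState) (m : ℕ → Public) (p : ℕ) : ℕ :=
  if s.clock < s.maxWeight.size then s.nbrBid p + (m p).bit.toNat * 2 ^ s.clock else s.nbrBid p

open Classical in
/-- The new state of a node, given what its neighbours publish. -/
noncomputable def next (s : NodeState) (m : ℕ → Public) : NodeState :=
  if s.halted then s
  else if s.price.isSome then
    { s with clock := s.clock + 1, halted := decide (∀ p < s.colour.deg, (m p).done) }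
  else
    { clock := s.clock + 1
      maxWeight := s.maxWeight
      bid := s.bid
      colour := s.colour.step s.clock {x | ∃ p < s.colour.deg, (m p).colour = x}
      nbrBid := s.nextNbrBid m
      sel := s.nextSel m
      multi := s.nextMulti m
      price := s.nextPrice m
      halted := false }

end NodeState

variable {V : Type} [Fintype V] {G : SimpleGraph V} [DecidableRel G.Adj] (ports : PortNumbering G)
  (W : ℕ) (ident b : V → ℕ)

/-- What a node receives if every node publishes `pub`. -/
def publicInbox (pub : V → Public) (v : V) (p : ℕ) : Public :=
  if h : p < G.degree v then pub (ports v ⟨p, h⟩).1 else Public.silent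

/-- The states after `t` rounds if stopped nodes keep publishing. -/
noncomputable def netRun : ℕ → V → NodeState
  | 0 => fun v => NodeState.initial W (ident v) (b v) (G.degree v)
  | t + 1 => fun v => (netRun t v).next (publicInbox ports (fun u => (netRun t u).toPublic) v)

/-- What the nodes receive in round `t` if stopped nodes keep publishing. -/
noncomputable def netInbox (t : ℕ) (v : V) : ℕ → Public :=
  publicInbox ports (fun u => (netRun ports W ident b t u).toPublic) v

end NetworkDefs

/-! ### Invariants of the idealised run -/

section NetworkTheory

open NodeState

variable {V : Type} [Fintype V] {G : SimpleGraph V} [DecidableRel G.Adj] (ports : PortNumbering G)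
  (W : ℕ) (ident b : V → ℕ)

local notation "N" => netRun ports W ident b
local notation "M" => netInbox ports W ident b

theorem netRun_succ (t : ℕ) (v : V) : N (t + 1) v = (N t v).next (M t v) := rfl

theorem publicInbox_eq (pub : V → Public) (v : V) {p : ℕ} (h : p < G.degree v) :
    publicInbox ports pub v p = pub (ports v ⟨p, h⟩).1 := dif_pos h

theorem netInbox_eq (t : ℕ) (v : V) (p : Fin (G.degree v)) :
    M t v p = (N t (ports v p).1).toPublic := publicInbox_eq ports _ v p.2

theorem exists_port {v u : V} (h : G.Adj v u) :
    ∃ p, ∃ hp : p < G.degree v, (ports v ⟨p, hp⟩).1 = u :=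
  ⟨((ports v).symm ⟨u, h⟩).1, ((ports v).symm ⟨u, h⟩).2, by simp⟩

theorem adj_port (v : V) (p : Fin (G.degree v)) : G.Adj v (ports v p).1 := (ports v p).2

@[simp] theorem netRun_maxWeight (t : ℕ) (v : V) : (N t v).maxWeight = W := by
  induction t with
  | zero => rfl
  | succ t ih => rw [netRun_succ, next]; split_ifs <;> exact ih

@[simp] theorem netRun_bid (t : ℕ) (v : V) : (N t v).bid = b v := by
  induction t with
  | zero => rfl
  | succ t ih => rw [netRun_succ, next]; split_ifs <;> exact ih

theorem netRun_clock {t : ℕ} {v : V} (h : (N t v).halted = false) : (N t v).clock = t := by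
  induction t with
  | zero => rfl
  | succ t ih =>
    rw [netRun_succ, next] at h ⊢
    split_ifs at h ⊢ with h1 h2
    · simp [h1] at h
    · simp only [Bool.not_eq_true] at h1
      simpa using ih h1
    · simp only [Bool.not_eq_true] at h1
      simpa using ih h1

/-- The fields of a state are determined one after the other. -/
theorem netRun_order (t : ℕ) (v : V) :
    ((N t v).halted → (N t v).price.isSome) ∧
    ((N t v).price.isSome → (N t v).multi.isSome) ∧
    ((N t v).multi.isSome → (N t v).sel.isSome) ∧
    ((N t v).sel.isSome → (N t v).colour.col.isSome ∧ W.size ≤ t) := by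
  induction t with
  | zero => simp [netRun, initial]
  | succ t ih =>
    obtain ⟨h1, h2, h3, h4⟩ := ih
    rw [netRun_succ, next]
    split_ifs with hs hp
    · exact ⟨h1, h2, h3, fun h => ⟨(h4 h).1, (h4 h).2.trans t.le_succ⟩⟩
    · exact ⟨fun _ => hp, h2, h3, fun h => ⟨(h4 h).1, (h4 h).2.trans t.le_succ⟩⟩
    · have hclock := netRun_clock ports W ident b (by simpa using hs)
      refine ⟨by simp, fun h => ?_, fun h => ?_, fun h => ?_⟩
      · simp only [nextPrice] at h
        split_ifs at h with h'
        · simp only [nextMulti, h'.1, if_true]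
        · simp at h
      · simp only [nextMulti] at h
        simp only [nextSel]
        split_ifs at h with h' h''
        · simp [h3 h']
        · simp [h''.1]
        · simp at h
      · simp only [nextSel] at h
        have key : (N t v).colour.col.isSome ∧ W.size ≤ t := by
          split_ifs at h with h' h''
          · exact h4 h'
          · rw [hclock, netRun_maxWeight] at h''
            exact ⟨h''.2.1, h''.1⟩
          · simp at h
        refine ⟨?_, key.2.trans t.le_succ⟩
        simp only [ColourState.step, key.1, if_true]

theorem col_isSome_of_price {t : ℕ} {v : V} (h : (N t v).price.isSome) :
    (N t v).colour.col.isSome ∧ W.size ≤ t :=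
  have h' := netRun_order ports W ident b t v
  h'.2.2.2 (h'.2.2.1 (h'.2.1 h))

theorem netRun_colour (t : ℕ) : ∀ v, (N t v).colour = colourRun G ident t v := by
  induction t with
  | zero => exact fun v => rfl
  | succ t ih =>
    intro v
    -- A node that knows its price no longer updates its colour state. Nothing is lost, because that
    -- state is frozen once coloured.
    have hkeep : (N t v).price.isSome → colourRun G ident (t + 1) v = colourRun G ident t v :=
      fun h => colourRun_eq_of_col G ident t.le_succ
        (by rw [← ih]; exact (col_isSome_of_price ports W ident b h).1)
    rw [netRun_succ, next]
    split_ifs with hs hp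
    · rw [hkeep ((netRun_order ports W ident b t v).1 hs), ih]
    · rw [hkeep hp, ← ih]
    · simp only [netRun_clock ports W ident b (by simpa using hs), ih, colourRun_deg]
      rw [colourRun]
      congr 1
      ext x
      constructor
      · rintro ⟨p, hp, rfl⟩
        rw [netInbox_eq ports W ident b t v ⟨p, hp⟩]
        exact ⟨_, (ports v ⟨p, hp⟩).2, (ih _).symm⟩
      · rintro ⟨u, hu, rfl⟩
        obtain ⟨p, hp, rfl⟩ := exists_port ports hu
        exact ⟨p, hp, by rw [netInbox_eq ports W ident b t v ⟨p, hp⟩]; exact ih _⟩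

@[simp] theorem netRun_deg (t : ℕ) (v : V) : (N t v).colour.deg = G.degree v := by
  rw [netRun_colour, colourRun_deg]

/-- Bids may be too long for one message, so round t carries bit t. Both ends use their own clock to
know which bit it is. -/
theorem netRun_nbrBid (t : ℕ) : ∀ (v : V) (p : Fin (G.degree v)),
    (N t v).nbrBid p = b (ports v p).1 % 2 ^ min t W.size := by
  induction t with
  | zero => simp [netRun, initial, Nat.mod_one]
  | succ t ih =>
    intro v p
    have hmin : W.size ≤ t → min (t + 1) W.size = min t W.size := by omega
    rw [netRun_succ, next]
    split_ifs with hs hp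
    · rw [hmin (col_isSome_of_price ports W ident b
        ((netRun_order ports W ident b t v).1 hs)).2, ih]
    · rw [hmin (col_isSome_of_price ports W ident b hp).2, ← ih]
    · simp only [nextNbrBid, netRun_clock ports W ident b (by simpa using hs), ih, netRun_maxWeight]
      split_ifs with hlt
      · rw [netInbox_eq]
        -- A clock stops only on halting, which requires a price and hence the end of the
        -- transmission of the bids.
        have hclock : (N t (ports v p).1).clock = t := by
          refine netRun_clock ports W ident b ?_
          by_contra h
          have := (col_isSome_of_price ports W ident b
            ((netRun_order ports W ident b t _).1 (by simpa using h))).2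
          omega
        simp only [toPublic, hclock, netRun_bid]
        rw [min_eq_left hlt.le, min_eq_left hlt, Nat.mod_pow_succ,
          Nat.toNat_testBit, mul_comm]
      · rw [hmin (not_lt.1 hlt)]

theorem netRun_nbrBid_eq (hb : ∀ v, b v ≤ W) {t : ℕ} (ht : W.size ≤ t) (v : V)
    (p : Fin (G.degree v)) : (N t v).nbrBid p = b (ports v p).1 := by
  rw [netRun_nbrBid, min_eq_right ht, Nat.mod_eq_of_lt]
  exact (hb _).trans_lt (Nat.lt_size_self W)

theorem netRun_persistent (t : ℕ) (v : V) :
    ((N t v).sel.isSome → (N (t + 1) v).sel = (N t v).sel) ∧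
    ((N t v).multi.isSome → (N (t + 1) v).multi = (N t v).multi) ∧
    ((N t v).price.isSome → (N (t + 1) v).price = (N t v).price) ∧
    ((N t v).halted → (N (t + 1) v).halted) := by
  rw [netRun_succ, next]
  split_ifs with hs hp
  · simp [hs]
  · simp [hs]
  · refine ⟨fun h => ?_, fun h => ?_, fun h => absurd h hp, fun h => absurd h hs⟩
    · simp [nextSel, h]
    · simp [nextMulti, h]

end NetworkTheory

/-! ### Correctness and running time of decisions and prices -/

section NetworkCorrect

open NodeState

variable {V : Type} [Fintype V] {G : SimpleGraph V} [DecidableRel G.Adj] (ports : PortNumbering G)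
  (W : ℕ) (ident b : V → ℕ)

local notation "N" => netRun ports W ident b
local notation "M" => netInbox ports W ident b

theorem halted_eq_false_of_price {t : ℕ} {v : V} (h : (N t v).price = none) :
    (N t v).halted = false := by
  by_contra hs
  have := (netRun_order ports W ident b t v).1 (by simpa using hs)
  simp [h] at this

theorem netRun_succ_of_price {t : ℕ} {v : V} (h : (N t v).price = none) :
    (N (t + 1) v).sel = (N t v).nextSel (M t v) ∧
    (N (t + 1) v).multi = (N t v).nextMulti (M t v) ∧
    (N (t + 1) v).price = (N t v).nextPrice (M t v) := by
  rw [netRun_succ, next, halted_eq_false_of_price ports W ident b h, h]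
  simp

theorem price_eq_none_of_multi {t : ℕ} {v : V} (h : (N t v).multi = none) :
    (N t v).price = none := by
  by_contra hs
  have := (netRun_order ports W ident b t v).2.1 (Option.isSome_iff_ne_none.2 hs)
  simp [h] at this

theorem multi_eq_none_of_sel {t : ℕ} {v : V} (h : (N t v).sel = none) :
    (N t v).multi = none := by
  by_contra hs
  have := (netRun_order ports W ident b t v).2.2.1 (Option.isSome_iff_ne_none.2 hs)
  simp [h] at this

theorem netRun_sel_mono {t t' : ℕ} (htt : t ≤ t') {v : V} (h : (N t v).sel.isSome) :
    (N t' v).sel = (N t v).sel := by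
  induction htt with
  | refl => rfl
  | step _ ih => rw [(netRun_persistent ports W ident b _ v).1 (by rwa [ih]), ih]

theorem netRun_multi_mono {t t' : ℕ} (htt : t ≤ t') {v : V} (h : (N t v).multi.isSome) :
    (N t' v).multi = (N t v).multi := by
  induction htt with
  | refl => rfl
  | step _ ih => rw [(netRun_persistent ports W ident b _ v).2.1 (by rwa [ih]), ih]

theorem netRun_price_mono {t t' : ℕ} (htt : t ≤ t') {v : V} (h : (N t v).price.isSome) :
    (N t' v).price = (N t v).price := by
  induction htt with
  | refl => rfl
  | step _ ih => rw [(netRun_persistent ports W ident b _ v).2.2.1 (by rwa [ih]), ih]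

theorem netRun_halted_mono {t t' : ℕ} (htt : t ≤ t') {v : V} (h : (N t v).halted) :
    (N t' v).halted := by
  induction htt with
  | refl => exact h
  | step _ ih => exact (netRun_persistent ports W ident b _ v).2.2.2 ih

variable {k : ℕ} {φ : V → Fin k}
  (hcol : ∀ t v a, (colourRun G ident t v).col = some a → a = (φ v : ℕ)) (hb : ∀ v, b v ≤ W)

include hcol in
theorem netRun_col {t : ℕ} {v : V} (h : (N t v).colour.col.isSome) :
    (N t v).colour.col.getD 0 = φ v := by
  obtain ⟨a, ha⟩ := Option.isSome_iff_exists.1 h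
  rw [ha, Option.getD_some]
  exact hcol t v a (by rw [← netRun_colour ports W ident b, ha])

include hcol hb in
theorem portAbove_iff {t : ℕ} (ht : W.size ≤ t) (v : V) (p : Fin (G.degree v))
    (hv : (N t v).colour.col.isSome) (hu : (N t (ports v p).1).colour.col.isSome) :
    (N t v).PortAbove (M t v) p ↔ Below φ b v (ports v p).1 := by
  rw [PortAbove, Below, netInbox_eq, toPublic, netRun_col ports W ident b hcol hv,
    netRun_col ports W ident b hcol hu, netRun_bid, netRun_nbrBid_eq ports W ident b hb ht,
    Fin.lt_def]

include hcol hb in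
theorem netRun_sel_succ_of_none {t : ℕ} {v : V} {x : Bool} (h : (N t v).sel = none)
    (h' : (N (t + 1) v).sel = some x) :
    (∀ u, G.Adj v u → Below φ b v u → (N t u).sel.isSome) ∧
      (x = true ↔ ∀ u, G.Adj v u → Below φ b v u → (N t u).sel = some false) := by
  rw [(netRun_succ_of_price ports W ident b (price_eq_none_of_multi ports W ident b
    (multi_eq_none_of_sel ports W ident b h))).1, nextSel, h, if_neg (by simp)] at h'
  split_ifs at h' with hc
  obtain ⟨hW, hv, hp⟩ := hc
  rw [netRun_maxWeight, netRun_clock ports W ident b (halted_eq_false_of_price ports W ident b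
    (price_eq_none_of_multi ports W ident b (multi_eq_none_of_sel ports W ident b h)))] at hW
  rw [netRun_deg] at hp h'
  have hp' : ∀ p : Fin (G.degree v), (N t (ports v p).1).colour.col.isSome := fun p => by
    have := (hp p p.2).1
    rwa [netInbox_eq] at this
  have habove := fun p => portAbove_iff ports W ident b hcol hb hW v p hv (hp' p)
  obtain rfl := Option.some.inj h'
  refine ⟨fun u hu hbelow => ?_, ?_⟩
  · obtain ⟨p, hpl, rfl⟩ := exists_port ports hu
    have := (hp p hpl).2 ((habove ⟨p, hpl⟩).2 hbelow)
    rwa [netInbox_eq ports W ident b t v ⟨p, hpl⟩] at this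
  · refine (@decide_eq_true_iff _ (_)).trans ?_
    constructor
    · intro H u hu hbelow
      obtain ⟨p, hpl, rfl⟩ := exists_port ports hu
      have := H p hpl ((habove ⟨p, hpl⟩).2 hbelow)
      rwa [netInbox_eq ports W ident b t v ⟨p, hpl⟩] at this
    · intro H p hpl ha
      rw [netInbox_eq ports W ident b t v ⟨p, hpl⟩]
      exact H _ (ports v ⟨p, hpl⟩).2 ((habove ⟨p, hpl⟩).1 ha)

variable [DecidableEq V] (hφ : ∀ u v, G.Adj u v → φ u ≠ φ v)

include hcol hb hφ in
-- The decision rule is the kernel equation, evaluated when all neighbours above have decided.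
theorem netRun_sel_eq {t : ℕ} {v : V} {x : Bool} (h : (N t v).sel = some x) :
    x = true ↔ v ∈ greedySet G φ b := by
  induction t generalizing v x with
  | zero => simp [netRun, initial] at h
  | succ t ih =>
    rcases hs : (N t v).sel with _ | y
    · obtain ⟨h1, h2⟩ := netRun_sel_succ_of_none ports W ident b hcol hb hs h
      rw [h2, isKernel_greedySet hφ b v]
      refine forall_congr' fun u => forall_congr' fun hu => forall_congr' fun hbl => ?_
      obtain ⟨y, hy⟩ := Option.isSome_iff_exists.1 (h1 u hu hbl)
      rw [hy, ← ih hy]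
      cases y <;> simp
    · rw [netRun_sel_mono ports W ident b t.le_succ (by simp [hs]), hs] at h
      exact ih (hs.trans h)

include hcol hb hφ in
theorem netRun_multi_eq {t : ℕ} {v : V} {x : Bool} (h : (N t v).multi = some x) :
    x = true ↔ ∃ u u', u ≠ u' ∧ (G.Adj v u ∧ Below φ b v u ∧ u ∈ greedySet G φ b) ∧
      G.Adj v u' ∧ Below φ b v u' ∧ u' ∈ greedySet G φ b := by
  induction t generalizing v x with
  | zero => simp [netRun, initial] at h
  | succ t ih =>
    rcases hs : (N t v).multi with _ | y
    · rw [(netRun_succ_of_price ports W ident b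
        (price_eq_none_of_multi ports W ident b hs)).2.1, nextMulti, hs, if_neg (by simp)] at h
      split_ifs at h with hc
      obtain ⟨hv, hp⟩ := hc
      rw [netRun_deg] at hp h
      obtain ⟨hv, hW⟩ := (netRun_order ports W ident b t v).2.2.2 hv
      have hp' : ∀ p : Fin (G.degree v), (N t (ports v p).1).sel.isSome := fun p => by
        have := hp p p.2
        rwa [netInbox_eq] at this
      have key : ∀ p : Fin (G.degree v), (N t v).PortAbove (M t v) p ∧ (M t v p).sel = some true ↔
          Below φ b v (ports v p).1 ∧ (ports v p).1 ∈ greedySet G φ b := by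
        intro p
        rw [portAbove_iff ports W ident b hcol hb hW v p hv
          ((netRun_order ports W ident b t _).2.2.2 (hp' p)).1]
        refine and_congr_right fun _ => ?_
        obtain ⟨y, hy⟩ := Option.isSome_iff_exists.1 (hp' p)
        rw [netInbox_eq, toPublic, hy, ← netRun_sel_eq ports W ident b hcol hb hφ hy]
        simp
      rw [← Option.some.inj h]
      refine (@decide_eq_true_iff _ (_)).trans ?_
      constructor
      · rintro ⟨p, hpl, p', hpl', hne, h1, h2⟩
        obtain ⟨h1, h1'⟩ := (key ⟨p, hpl⟩).1 h1
        obtain ⟨h2, h2'⟩ := (key ⟨p', hpl'⟩).1 h2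
        refine ⟨_, _, fun heq => hne ?_, ⟨(ports v ⟨p, hpl⟩).2, h1, h1'⟩,
          (ports v ⟨p', hpl'⟩).2, h2, h2'⟩
        exact Fin.mk.inj ((ports v).injective (Subtype.ext heq))
      · rintro ⟨u, u', hne, ⟨hu, h1⟩, hu', h2⟩
        obtain ⟨p, hpl, rfl⟩ := exists_port ports hu
        obtain ⟨p', hpl', rfl⟩ := exists_port ports hu'
        refine ⟨p, hpl, p', hpl', fun heq => hne ?_, (key ⟨p, hpl⟩).2 h1, (key ⟨p', hpl'⟩).2 h2⟩
        subst heq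
        rfl
    · rw [netRun_multi_mono ports W ident b t.le_succ (by simp [hs]), hs] at h
      exact ih (hs.trans h)

include hcol hb hφ in
-- Only for selected v is the number meaningful: v itself then counts among the selected nodes above
-- each lower neighbour u, so a second one is precisely a blocking neighbour. Thus u can tell all
-- its neighbours the same bit.
theorem netRun_price_eq {t : ℕ} {v : V} {x : ℕ} (h : (N t v).price = some x)
    (hv : v ∈ greedySet G φ b) : x = blockingPrice G φ b v := by
  induction t generalizing x with
  | zero => simp [netRun, initial] at h
  | succ t ih =>
    rcases hs : (N t v).price with _ | y
    · rw [(netRun_succ_of_price ports W ident b hs).2.2, nextPrice] at h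
      split_ifs at h with hc
      obtain ⟨hm, hp⟩ := hc
      rw [netRun_deg] at hp h
      have hsel := (netRun_order ports W ident b t v).2.2.1 hm
      obtain ⟨hvc, hW⟩ := (netRun_order ports W ident b t v).2.2.2 hsel
      have hp' : ∀ p : Fin (G.degree v), (N t (ports v p).1).multi.isSome := fun p => by
        have := hp p p.2
        rwa [netInbox_eq] at this
      have hpc : ∀ p : Fin (G.degree v), (N t (ports v p).1).colour.col.isSome := fun p =>
        have h := netRun_order ports W ident b t (ports v p).1
        (h.2.2.2 (h.2.2.1 (hp' p))).1
      have key : ∀ p : Fin (G.degree v),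
          ¬ (N t v).PortAbove (M t v) p ∧ (M t v p).multi = some false ↔
          Below φ b (ports v p).1 v ∧ ¬ Blocked G φ b v (ports v p).1 := by
        intro p
        have hadj := adj_port ports v p
        rw [portAbove_iff ports W ident b hcol hb hW v p hvc (hpc p)]
        have : ¬ Below φ b v (ports v p).1 ↔ Below φ b (ports v p).1 v :=
          ⟨fun h => (below_or_below hφ b hadj).resolve_left h, fun h => h.asymm⟩
        rw [this]
        refine and_congr_right fun hbel => ?_
        obtain ⟨y, hy⟩ := Option.isSome_iff_exists.1 (hp' p)
        have hy' := netRun_multi_eq ports W ident b hcol hb hφ hy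
        have hbl : Blocked G φ b v (ports v p).1 ↔ y = true := by
          rw [hy']
          constructor
          · rintro ⟨x, hx, hxv, hbx, hxS⟩
            exact ⟨x, v, hxv, ⟨hx, hbx, hxS⟩, hadj.symm, hbel, hv⟩
          -- Of two distinct selected nodes above u at least one differs from v.
          · rintro ⟨x, x', hne, ⟨hx, hbx, hxS⟩, hx', hbx', hxS'⟩
            by_cases hxv : x = v
            · exact ⟨x', hx', fun h => hne (hxv.trans h.symm), hbx', hxS'⟩
            · exact ⟨x, hx, hxv, hbx, hxS⟩
        rw [hbl, netInbox_eq, toPublic, hy]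
        simp
      rw [← Option.some.inj h, blockingPrice]
      refine eq_of_forall_ge_iff fun c => ?_
      rw [Finset.sup_le_iff, Finset.sup_le_iff]
      simp only [Finset.mem_range, Finset.mem_filter, Finset.mem_univ, true_and, and_imp]
      have hval : ∀ p : Fin (G.degree v),
          (if (N t v).colour.col.getD 0 < (M t v p).colour.col.getD 0 then (N t v).nbrBid p
            else (N t v).nbrBid p + 1) =
          if φ v < φ (ports v p).1 then b (ports v p).1 else b (ports v p).1 + 1 := by
        intro p
        rw [netInbox_eq, toPublic, netRun_col ports W ident b hcol hvc,
          netRun_col ports W ident b hcol (hpc p), netRun_nbrBid_eq ports W ident b hb hW]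
        simp only [Fin.lt_def]
      constructor
      · intro H u hu hbel hbl
        obtain ⟨p, hpl, rfl⟩ := exists_port ports hu
        have := H p hpl
        rwa [if_pos ((key ⟨p, hpl⟩).2 ⟨hbel, hbl⟩), hval ⟨p, hpl⟩] at this
      · intro H p hpl
        rw [hval ⟨p, hpl⟩]
        by_cases hcond : ¬ (N t v).PortAbove (M t v) p ∧ (M t v p).multi = some false
        · rw [if_pos hcond]
          obtain ⟨h1, h2⟩ := (key ⟨p, hpl⟩).1 hcond
          exact H _ (adj_port ports v ⟨p, hpl⟩) h1 h2
        · rw [if_neg hcond]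
          exact Nat.zero_le c
    · rw [netRun_price_mono ports W ident b t.le_succ (by simp [hs]), hs] at h
      exact ih (hs.trans h)

include hcol hb in
/-- The nodes decide in descending order. -/
theorem sel_isSome {T : ℕ} (hT : ∀ v, (colourRun G ident T v).col.isSome) (hW : W.size ≤ T)
    (r : ℕ) : ∀ v, (W - b v) * k + φ v ≤ r → (N (T + r + 1) v).sel.isSome := by
  induction r using Nat.strong_induction_on with
  | _ r ih =>
    intro v hr
    by_cases hs : (N (T + r) v).sel.isSome
    · rwa [netRun_sel_mono ports W ident b (Nat.le_succ _) hs]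
    · have hs' : (N (T + r) v).sel = none := by simpa using hs
      have hprice := price_eq_none_of_multi ports W ident b (multi_eq_none_of_sel ports W ident b hs')
      have hclock := netRun_clock ports W ident b (halted_eq_false_of_price ports W ident b hprice)
      have hc : ∀ u, (N (T + r) u).colour.col.isSome := fun u => by
        rw [netRun_colour, colourRun_eq_of_col G ident (Nat.le_add_right T r) (hT u)]
        exact hT u
      rw [(netRun_succ_of_price ports W ident b hprice).1, nextSel, if_neg hs, if_pos]
      · rfl
      · rw [netRun_maxWeight, hclock, netRun_deg]
        refine ⟨by omega, hc v, fun p hp => ?_⟩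
        rw [portAbove_iff ports W ident b hcol hb (by omega) v ⟨p, hp⟩ (hc v) (hc _),
          netInbox_eq ports W ident b _ v ⟨p, hp⟩]
        refine ⟨hc _, fun hbel => ?_⟩
        set u := (ports v ⟨p, hp⟩).1
        -- A higher node has smaller rank: a larger bid saves a full `k`, more than any colour, and
        -- a tie is decided by the smaller colour.
        have hlt : (W - b u) * k + φ u < (W - b v) * k + φ v := by
          rcases hbel with h | ⟨h, h'⟩
          · have h1 : (W - b u + 1) * k ≤ (W - b v) * k :=
              Nat.mul_le_mul_right k (by have := hb u; omega)
            have h2 := (φ u).2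
            rw [add_mul, one_mul] at h1
            omega
          · rw [h]
            exact Nat.add_lt_add_left h' _
        have := ih _ (lt_of_lt_of_le hlt hr) u le_rfl
        rw [toPublic]
        change (N (T + r) u).sel.isSome
        rwa [netRun_sel_mono ports W ident b (by omega) this]

/-- After the last decision one round each yields the bits on two dominators, the prices, and the
knowledge that all neighbours are done. -/
theorem halted_of_sel {T : ℕ} (hT : ∀ v, (N T v).sel.isSome) (v : V) : (N (T + 3) v).halted := by
  have hmulti : ∀ v, (N (T + 1) v).multi.isSome := by
    intro v
    by_cases hs : (N T v).multi.isSome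
    · rwa [netRun_multi_mono ports W ident b (Nat.le_succ _) hs]
    · rw [(netRun_succ_of_price ports W ident b
        (price_eq_none_of_multi ports W ident b (by simpa using hs))).2.1, nextMulti, if_neg hs,
        if_pos]
      · rfl
      · refine ⟨hT v, fun p hp => ?_⟩
        rw [netRun_deg] at hp
        rw [netInbox_eq ports W ident b _ v ⟨p, hp⟩]
        exact hT _
  have hprice : ∀ v, (N (T + 2) v).price.isSome := by
    intro v
    by_cases hs : (N (T + 1) v).price.isSome
    · rwa [netRun_price_mono ports W ident b (Nat.le_succ _) hs]
    · rw [(netRun_succ_of_price ports W ident b (by simpa using hs)).2.2, nextPrice, if_pos]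
      · rfl
      · refine ⟨hmulti v, fun p hp => ?_⟩
        rw [netRun_deg] at hp
        rw [netInbox_eq ports W ident b _ v ⟨p, hp⟩]
        exact hmulti _
  by_cases hs : (N (T + 2) v).halted
  · exact netRun_halted_mono ports W ident b (Nat.le_succ _) hs
  · rw [netRun_succ, next, if_neg hs, if_pos (hprice v)]
    simp only [decide_eq_true_iff]
    intro p hp
    rw [netRun_deg] at hp
    rw [netInbox_eq ports W ident b _ v ⟨p, hp⟩]
    exact hprice _

end NetworkCorrect

/-! ### Messages as bit strings -/

section Encoding

theorem bits_injective : Function.Injective Nat.bits := by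
  have h : Function.LeftInverse (List.foldr (fun (b : Bool) (m : ℕ) => 2 * m + b.toNat) 0)
      Nat.bits := by
    intro n
    induction n using Nat.strong_induction_on with
    | _ n ih =>
      rcases Nat.even_or_odd' n with ⟨m, rfl | rfl⟩
      · rcases Nat.eq_zero_or_pos m with rfl | hm
        · simp
        · rw [Nat.bit0_bits m hm.ne', List.foldr_cons, ih m (by omega)]
          simp
      · rw [Nat.bit1_bits, List.foldr_cons, ih m (by omega)]
        simp
  exact Function.LeftInverse.injective h

/-- A number for an optional number. -/
def optionCode (o : Option ℕ) : ℕ := o.elim 0 (· + 1)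

theorem optionCode_injective : Function.Injective optionCode := by
  rintro (_ | a) (_ | b) h <;> simp_all [optionCode]

/-- A number for a truth value and three flags. -/
noncomputable def flagCode (x : Bool × Option Bool × Option Bool × Bool) : ℕ :=
  (Fintype.equivFin _ x).1

theorem flagCode_injective : Function.Injective flagCode := fun _ _ h =>
  (Fintype.equivFin _).injective (Fin.ext h)

theorem flagCode_lt (x : Bool × Option Bool × Option Bool × Bool) : flagCode x < 36 :=
  (Fintype.equivFin _ x).2.trans_eq (by simp)

namespace Public

/-- A positive number for the published part of a state. -/
noncomputable def code (p : Public) : ℕ :=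
  Nat.pair (Nat.pair p.colour.ident p.colour.deg)
    (Nat.pair p.colour.lin (Nat.pair (optionCode p.colour.fin)
      (Nat.pair (optionCode p.colour.col) (flagCode (p.bit, p.sel, p.multi, p.done))))) + 1

theorem code_injective : Function.Injective code := by
  rintro ⟨⟨a, b, c, d, e⟩, f, g, h, i⟩ ⟨⟨a', b', c', d', e'⟩, f', g', h', i'⟩ H
  simp only [code, Nat.add_right_cancel_iff, Nat.pair_eq_pair, optionCode_injective.eq_iff,
    flagCode_injective.eq_iff, Prod.mk.injEq] at H
  obtain ⟨⟨rfl, rfl⟩, rfl, rfl, rfl, rfl, rfl, rfl, rfl⟩ := H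
  rfl

/-- The message for the published part of a state. -/
noncomputable def encode (p : Public) : List Bool := p.code.bits

theorem encode_injective : Function.Injective encode := bits_injective.comp code_injective

/-- The empty string stays reserved for silence; this is the purpose of the summand 1 in `code`. -/
theorem encode_ne_nil (p : Public) : p.encode ≠ [] := by
  intro h
  have := bits_injective (h.trans Nat.zero_bits.symm)
  simp [code] at this

instance : Nonempty Public := ⟨silent⟩

/-- The reading of a message. -/
noncomputable def decode (l : List Bool) : Public :=
  if l = [] then silent else Function.invFun encode l

theorem decode_nil : decode [] = silent := if_pos rfl

theorem decode_encode (p : Public) : decode p.encode = p := by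
  rw [decode, if_neg p.encode_ne_nil]
  exact Function.leftInverse_invFun encode_injective p

theorem pair_lt_two_pow {a c K : ℕ} (ha : a < 2 ^ K) (hc : c < 2 ^ K) :
    Nat.pair a c < 2 ^ (2 * K) := by
  refine (Nat.pair_lt_max_add_one_sq a c).trans_le ?_
  rw [mul_comm, pow_mul]
  exact Nat.pow_le_pow_left (max_lt ha hc) 2

/-- Pairing doubles the binary length. Four nested pairings bring K to 16 K, so 32 K is generous,
and 6 ≤ K leaves room for the 36 flag values. -/
theorem length_encode_le {p : Public} {K : ℕ} (h1 : p.colour.ident < 2 ^ K)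
    (h2 : p.colour.deg < 2 ^ K) (h3 : p.colour.lin < 2 ^ K) (h4 : optionCode p.colour.fin < 2 ^ K)
    (h5 : optionCode p.colour.col < 2 ^ K) (h6 : 6 ≤ K) : p.encode.length ≤ 32 * K + 1 := by
  have mono : ∀ {x a c : ℕ}, x < 2 ^ a → a ≤ c → x < 2 ^ c := fun h hac =>
    h.trans_le (Nat.pow_le_pow_right (by norm_num) hac)
  have hf : flagCode (p.bit, p.sel, p.multi, p.done) < 2 ^ K :=
    mono ((flagCode_lt _).trans (by norm_num : 36 < 2 ^ 6)) h6
  have e1 := pair_lt_two_pow h5 hf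
  have e2 := pair_lt_two_pow (mono h4 (by omega)) e1
  have e3 := pair_lt_two_pow (mono h3 (by omega)) e2
  have e4 := pair_lt_two_pow (mono (pair_lt_two_pow h1 h2) (by omega)) e3
  rw [encode, Nat.size_eq_bits_len, Nat.size_le, code]
  have := mono (c := 32 * K) e4 (by omega)
  rw [pow_succ]
  omega

end Public

end Encoding

/-! ### The distributed algorithm and its comparison with the idealised run -/

section Algorithm

open NodeState

/-- The distributed auction. A node without neighbours stops at once. -/
noncomputable def auction : DistAlgorithm where
  State := NodeState
  init := NodeState.initial
  send s _ := s.toPublic.encode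
  receive s inbox := s.next fun p => Public.decode (inbox p)
  output s :=
    if s.colour.deg = 0 then some (true, 0)
    else if s.halted then
      some (s.sel.getD false, if s.sel = some true then -((s.price.getD 0 : ℕ) : ℝ) else 0)
    else none

variable {V : Type} [Fintype V] {G : SimpleGraph V} [DecidableRel G.Adj] (ports : PortNumbering G)
  (W : ℕ) (ident b : V → ℕ)

local notation "N" => netRun ports W ident b
local notation "M" => netInbox ports W ident b

theorem price_isSome_of_halted_adj {t : ℕ} {u v : V} (h : (N t u).halted) (huv : G.Adj u v) :
    (N t v).price.isSome := by
  induction t with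
  | zero => simp [netRun, initial] at h
  | succ t ih =>
    by_cases hs : (N t u).halted
    · have := ih hs
      rwa [netRun_price_mono ports W ident b t.le_succ this]
    · rw [netRun_succ, next, if_neg hs] at h
      split_ifs at h with hp
      · simp only [decide_eq_true_iff] at h
        obtain ⟨p, hpl, rfl⟩ := exists_port ports huv
        have := h p (by rwa [netRun_deg])
        rw [netInbox_eq ports W ident b t u ⟨p, hpl⟩] at this
        have this : (N t (ports u ⟨p, hpl⟩).1).price.isSome := this
        rwa [netRun_price_mono ports W ident b t.le_succ this]

theorem auction_output_netRun {t : ℕ} {v : V} (hv : 0 < G.degree v) :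
    (auction.output (N t v)).isSome = (N t v).halted := by
  simp only [auction, netRun_deg, hv.ne', if_false]
  cases (N t v).halted <;> simp

/-- The actual states are those of the run in which stopped nodes keep publishing. -/
theorem config_eq_netRun (t : ℕ) : ∀ v, 0 < G.degree v →
    auction.config ports W ident b t v = N t v := by
  induction t with
  | zero => exact fun v _ => rfl
  | succ t ih =>
    intro v hv
    have hstep : auction.config ports W ident b (t + 1) v =
        auction.round ports (auction.config ports W ident b t) v := by
      rw [DistAlgorithm.config, Function.iterate_succ_apply']
      rfl
    rw [hstep, DistAlgorithm.round, ih v hv, auction_output_netRun ports W ident b hv]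
    by_cases hs : (N t v).halted
    · refine (if_pos hs).trans ?_
      rw [netRun_succ, next, if_pos hs]
    · refine (if_neg hs).trans ?_
      rw [netRun_succ]
      have hinbox : ∀ p : Fin (G.degree v), Public.decode
          (auction.inbox ports (auction.config ports W ident b t) v p) =
          if (N t (ports v p).1).halted then Public.silent else M t v p := by
        intro p
        have hadj := adj_port ports v p
        have hu : 0 < G.degree (ports v p).1 :=
          (G.degree_pos_iff_exists_adj _).2 ⟨v, hadj.symm⟩
        rw [DistAlgorithm.inbox, dif_pos p.2, DistAlgorithm.message]
        simp only [Fin.eta]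
        rw [ih _ hu, auction_output_netRun ports W ident b hu]
        split_ifs with h
        · exact Public.decode_nil
        · rw [netInbox_eq]
          exact Public.decode_encode _
      change (N t v).next _ = _
      -- With a price, v reads only the field `done`, and silence is read as done, which is true of
      -- a stopped node. Without a price, v has no stopped neighbour, so all messages are genuine.
      by_cases hp : (N t v).price.isSome
      · simp only [next, if_neg hs, if_pos hp, netRun_deg]
        have : (∀ p < G.degree v, (Public.decode
            (auction.inbox ports (auction.config ports W ident b t) v p)).done = true) ↔
            ∀ p < G.degree v, (M t v p).done = true := by
          refine forall_congr' fun p => forall_congr' fun hpl => ?_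
          rw [hinbox ⟨p, hpl⟩]
          split_ifs with h
          · rw [netInbox_eq ports W ident b t v ⟨p, hpl⟩]
            simpa [Public.silent, toPublic] using (netRun_order ports W ident b t _).1 h
          · rfl
        simp only [this]
      · congr 1
        ext1 p
        by_cases hpl : p < G.degree v
        · rw [hinbox ⟨p, hpl⟩, if_neg]
          exact fun h => hp (price_isSome_of_halted_adj ports W ident b h
            (adj_port ports v ⟨p, hpl⟩).symm)
        · rw [DistAlgorithm.inbox, dif_neg hpl, Public.decode_nil, netInbox, publicInbox,
            dif_neg hpl]

/-- Isolated nodes must stop at time 0, because for n = 1 the round bound is 0. -/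
theorem auction_output_of_degree_eq_zero (t : ℕ) {v : V} (hv : G.degree v = 0) :
    auction.output (auction.config ports W ident b t v) = some (true, 0) := by
  have h0 : auction.output (initial W (ident v) (b v) (G.degree v)) = some (true, 0) := by
    simp [auction, initial, hv]
  have : auction.config ports W ident b t v = initial W (ident v) (b v) (G.degree v) := by
    induction t with
    | zero => rfl
    | succ t ih =>
      have hstep : auction.config ports W ident b (t + 1) v =
          auction.round ports (auction.config ports W ident b t) v := by
        rw [DistAlgorithm.config, Function.iterate_succ_apply']
        rfl
      rw [hstep, DistAlgorithm.round, ih, h0]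
      rfl
  rw [this, h0]

theorem two_pow_nodeScale_le (v : V) : 2 ^ nodeScale G v ≤ 2 * G.degree v + 1 := by
  unfold nodeScale
  rcases Nat.eq_zero_or_pos (G.degree v) with h | h
  · simp [h]
  · have h1 : 0 < (G.degree v).size := Nat.size_pos.2 h
    have h2 : 2 ^ ((G.degree v).size - 1) ≤ G.degree v := Nat.lt_size.1 (by omega)
    calc 2 ^ (G.degree v).size = 2 * 2 ^ ((G.degree v).size - 1) := by
          rw [← pow_succ']; congr 1; omega
      _ ≤ _ := by omega

theorem length_toPublic_le (hid : Function.Injective ident) {c : ℕ}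
    (hc : ∀ v, ident v ≤ c * Fintype.card V ^ c) (hn : 2 ≤ Fintype.card V) (t : ℕ) (v : V) :
    (N t v).toPublic.encode.length ≤ (96 * c + 300) * Nat.log 2 (Fintype.card V) := by
  set l := Nat.log 2 (Fintype.card V) with hl
  have hl1 : 1 ≤ l := (Nat.le_log_iff_pow_le (by norm_num) (by omega)).2 (by simpa using hn)
  have hnl : Fintype.card V < 2 ^ (2 * l) :=
    (Nat.lt_pow_succ_log_self (by norm_num) _).trans_le
      (Nat.pow_le_pow_right (by norm_num) (by omega))
  have hdeg : G.degree v < Fintype.card V := G.degree_lt_card_verts v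
  -- A preliminary colour is below 16 * 2 ^ sc ≤ 16 * (2 deg + 1), so 64 n covers it with its option
  -- code.
  have hbig : 64 * Fintype.card V ≤ 2 ^ ((3 * c + 8) * l) := by
    calc 64 * Fintype.card V ≤ 2 ^ 6 * 2 ^ (2 * l) := Nat.mul_le_mul (by norm_num) hnl.le
      _ = 2 ^ (6 + 2 * l) := (pow_add _ _ _).symm
      _ ≤ _ := Nat.pow_le_pow_right (by norm_num) (by nlinarith)
  have hident : ident v < 2 ^ ((3 * c + 8) * l) := by
    have h1 : c < 2 ^ (c * l) :=
      Nat.lt_two_pow_self.trans_le (Nat.pow_le_pow_right (by norm_num) (by nlinarith))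
    have h2 : Fintype.card V ^ c ≤ 2 ^ (2 * l * c) := by
      rw [pow_mul]
      exact Nat.pow_le_pow_left hnl.le c
    calc ident v ≤ c * Fintype.card V ^ c := hc v
      _ < 2 ^ (c * l) * 2 ^ (2 * l * c) := Nat.mul_lt_mul_of_lt_of_le h1 h2 (by positivity)
      _ = 2 ^ (c * l + 2 * l * c) := (pow_add _ _ _).symm
      _ ≤ _ := Nat.pow_le_pow_right (by norm_num) (by nlinarith)
  refine (Public.length_encode_le (K := (3 * c + 8) * l) ?_ ?_ ?_ ?_ ?_ (by nlinarith)).trans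
    (by nlinarith)
  all_goals
    simp only [toPublic, netRun_colour, colourRun_ident, colourRun_deg]
  · exact hident
  · omega
  · exact (colourRun_lin_le_ident G ident hid t v).trans_lt hident
  · rcases h : (colourRun G ident t v).fin with _ | a
    · simp [optionCode]
    · have h1 := colourRun_fin_lt G ident h
      have h2 := paletteSize_le (nodeScale G v)
      have h3 := two_pow_nodeScale_le (G := G) v
      simp only [optionCode, Option.elim_some]
      omega
  · rcases h : (colourRun G ident t v).col with _ | a
    · simp [optionCode]
    · have h1 := colourRun_col_le_degree G ident h
      simp only [optionCode, Option.elim_some]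
      omega

end Algorithm

/-! ### The main theorem -/

theorem theorem4p1 :
    ∃ A : DistAlgorithm, ∀ c : ℕ, ∃ C : ℕ,
      ∀ (W : ℕ), 1 ≤ W →
      ∀ (V : Type) [Fintype V] [DecidableEq V] (G : SimpleGraph V) [DecidableRel G.Adj]
        (ports : PortNumbering G) (ident : V → ℕ), Function.Injective ident →
        (∀ v, ident v ≤ c * Fintype.card V ^ c) →
      ∃ φ : G.Coloring (Fin (G.maxDegree + 1)),
        (greedyMechanism G φ).ComputedBy A ports ident W
          (C * (G.maxDegree * W + logStar (Fintype.card V)))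
          (C * Nat.log 2 (Fintype.card V)) ∧
        (greedyMechanism G φ).IncentiveCompatible G W ∧
        (greedyMechanism G φ).IsApproximation G W (max 1 (G.maxDegree : ℝ)) ∧
        (∀ b : V → ℕ, (∀ u, b u ≤ W) → ∀ v ∈ greedySet G φ b,
          criticalPrice G φ b v = blockingPrice G φ b v) := by
  -- One constant serves both bounds: messages have at most 32 * (3c + 8) * log n + 1 bits, and the
  -- round count has smaller coefficients.
  refine ⟨auction, fun c => ⟨96 * c + 300, fun W hW V _ _ G _ ports ident hid hc => ?_⟩⟩
  obtain ⟨φ, hcol, hdone⟩ := exists_coloring G ident hid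
    (J := Finset.univ.sup (nodeLevel G ident)) (B := 2 * G.maxDegree + 1)
    (fun v => Finset.le_sup (Finset.mem_univ v)) (fun v => (two_pow_nodeScale_le v).trans
      (by have := G.degree_le_maxDegree v; omega))
  have hφ : ∀ u v, G.Adj u v → φ u ≠ φ v := fun u v h => φ.valid h
  refine ⟨φ, fun b hb => ⟨fun v => ?_, fun t u v h => ?_⟩,
    greedyMechanism_incentiveCompatible hφ W, greedyMechanism_isApproximation hφ W,
    fun b _ v hv => criticalPrice_eq_blockingPrice hφ hv⟩
  · change _ = some (decide (v ∈ greedySet G φ b),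
      if v ∈ greedySet G φ b then -(criticalPrice G φ b v : ℝ) else 0)
    rcases Nat.eq_zero_or_pos (G.degree v) with hdeg | hdeg
    · have hno : ∀ u, ¬ G.Adj v u := fun u hu =>
        hdeg.not_gt ((G.degree_pos_iff_exists_adj v).2 ⟨u, hu⟩)
      have hv : v ∈ greedySet G φ b :=
        (isKernel_greedySet hφ b v).2 fun u hu => absurd hu (hno u)
      have hprice : criticalPrice G φ b v = 0 := by
        rw [criticalPrice_eq_blockingPrice hφ hv, blockingPrice]
        simp [hno]
      rw [auction_output_of_degree_eq_zero ports W ident b _ hdeg]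
      simp [hv, hprice]
    · obtain ⟨u, hu⟩ := (G.degree_pos_iff_exists_adj v).1 hdeg
      have hn : 2 ≤ Fintype.card V := by
        have := G.degree_lt_card_verts v
        omega
      have hΔ : 1 ≤ G.maxDegree := hdeg.trans_le (G.degree_le_maxDegree v)
      have hJ : Finset.univ.sup (nodeLevel G ident) ≤ logStar (Fintype.card V) + (c + 1) :=
        Finset.sup_le fun v _ => startLevel_le c _ _ _ hn (hc v)
      have hsize : W.size ≤ W := Nat.size_le.2 Nat.lt_two_pow_self
      -- At time `T₀` the colouring is complete and, owing to the summand `W`, all bits of the bids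
      -- have arrived. The number `r` bounds the ranks, and three further rounds after the decisions
      -- lead to halting.
      set T₀ := logStar (Fintype.card V) + (c + 1) + 48 * (2 * G.maxDegree + 1) + 1 + W with hT₀
      set r := W * (G.maxDegree + 1) + G.maxDegree with hr
      have hT : T₀ + r + 1 + 3 ≤
          (96 * c + 300) * (G.maxDegree * W + logStar (Fintype.card V)) := by
        have h1 : W ≤ G.maxDegree * W := Nat.le_mul_of_pos_left W hΔ
        have h2 : G.maxDegree ≤ G.maxDegree * W := Nat.le_mul_of_pos_right _ hW
        have h3 : 1 ≤ G.maxDegree * W := hΔ.trans h2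
        have h4 : c ≤ c * (G.maxDegree * W + logStar (Fintype.card V)) :=
          Nat.le_mul_of_pos_right _ (by omega)
        have h5 : W * (G.maxDegree + 1) = G.maxDegree * W + W := by ring
        rw [add_mul, mul_assoc]
        omega
      have hcolT : ∀ v, (colourRun G ident T₀ v).col.isSome := fun v => by
        rw [hdone T₀ (by omega) v]
        rfl
      have hsel : ∀ v, (netRun ports W ident b (T₀ + r + 1) v).sel.isSome := fun v => by
        refine sel_isSome ports W ident b hcol hb hcolT (by omega) r v ?_
        have h1 : (W - b v) * (G.maxDegree + 1) ≤ W * (G.maxDegree + 1) :=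
          Nat.mul_le_mul_right _ (Nat.sub_le _ _)
        have h2 := (φ v).2
        omega
      have h_halted := netRun_halted_mono ports W ident b hT (halted_of_sel ports W ident b hsel v)
      generalize (96 * c + 300) * (G.maxDegree * W + logStar (Fintype.card V)) = T at h_halted
      have horder := netRun_order ports W ident b T v
      obtain ⟨x, hx⟩ := Option.isSome_iff_exists.1 (horder.1 h_halted)
      obtain ⟨y, hy⟩ := Option.isSome_iff_exists.1
        (horder.2.2.1 (horder.2.1 (horder.1 h_halted)))
      have hy' := netRun_sel_eq ports W ident b hcol hb hφ hy
      rw [config_eq_netRun ports W ident b T v hdeg]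
      simp only [auction, netRun_deg, hdeg.ne', if_false, h_halted, if_true, hy, hx,
        Option.getD_some, Option.some.injEq, Prod.mk.injEq]
      by_cases hv : v ∈ greedySet G φ b
      · have hprice := netRun_price_eq ports W ident b hcol hb hφ hx hv
        rw [← criticalPrice_eq_blockingPrice hφ hv] at hprice
        simp [hv, hy'.2 hv, hprice]
      · have hyf : y = false := by
          rw [← Bool.not_eq_true, hy']
          exact hv
        simp [hv, hyf]
  · have hu : 0 < G.degree u := (G.degree_pos_iff_exists_adj u).2 ⟨v, h⟩
    have hn : 2 ≤ Fintype.card V := by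
      have := G.degree_lt_card_verts u
      omega
    rw [DistAlgorithm.message, config_eq_netRun ports W ident b t u hu]
    split_ifs
    · simp
    · exact length_toPublic_le ports W ident b hid hc hn t u
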